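/- Let $n\ge 1$, $r\ge 0$ and $f_1,\dots,f_n:\mathbb R^r\to\mathbb R$ be differentiable with $\langle\nabla f_i(x)-\nabla f_i(x'),x-x'\rangle\ge\mu\|x-x'\|^2$ and $\|\nabla f_i(x)-\nabla f_i(x')\|\le L\|x-x'\|$ for all $x,x'$ and $i$, where $\mu>0$, and let $x^*$ be the minimizer of $\frac1n\sum_i f_i$. Let $W=[w_{ij}]\in\mathbb R^{n\times n}$ be nonnegative, symmetric and doubly stochastic with $w_{ii}>0$ for all $i$, such that the graph on $\{1,\dots,n\}$ with an edge between $i\ne j$ iff $w_{ij}>0$ is connected. Let $\eta_{i,k},\xi_{i,k}$ ($1\le i\le n$, $k\ge0$) be random vectors in $\mathbb R^r$ whose coordinates are independent over iterations $k$, agents $i$ and coordinates $j$ (that is, the pairs $(\eta_{ij,k},\xi_{ij,k})$ are mutually independent over all $(k,i,j)$), with zero means and $\mathbb E\sum_i\|\eta_{i,k}\|^2\le\sigma_\eta^2$, $\mathbb E\sum_i\|\xi_{i,k}\|^2\le\sigma_\xi^2$ for all $k$ and some constants $\sigma_\eta,\sigma_\xi>0$. Given $\alpha,\gamma>0$, $p,q\ge0$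 and $m>0$, put $\gamma_k=\gamma/(m+k)^p$, $\beta_k=1/(m+k)^q$, and, from arbitrary deterministic initial states $s_{i,0},x_{i,0}\in\mathbb R^r$, define for $k\ge 0$ $$s_{i,k+1}=w_{ii}s_{i,k}+\sum_{j\ne i}w_{ij}(s_{j,k}+\beta_k\eta_{j,k})+\gamma_k\nabla f_i(x_{i,k}),$$ $$x_{i,k+1}=w_{ii}x_{i,k}+\sum_{j\ne i}w_{ij}(x_{j,k}+\beta_k\xi_{j,k})-\alpha(s_{i,k+1}-s_{i,k}).$$ Let $y_{i,k}=s_{i,k+1}-s_{i,k}$, $\bar x_k=\frac1n\sum_i x_{i,k}$, $\bar y_k=\frac1n\sum_i y_{i,k}$, and $$U_k=\mathbb E\|\bar x_k-x^*\|^2,\qquad X_k=\mathbb E\sum_i\|x_{i,k}-\bar x_k\|^2,\qquad Y_k=\mathbb E\sum_i\|y_{i,k}-\bar y_k\|^2.$$ Let $\rho_w$ be the spectral radius of $W-\frac1n\mathbf 1\mathbf 1^T$, and let $d_I=\|I-\frac1n\mathbf 1\mathbf 1^T\|$, where the norm of a matrix is the square root of the sum of the squares of its entries. Then there exists $m>0$,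 depending only on $r,W,\mu,L,\alpha,\gamma,p,q$, such that $U_k,X_k,Y_k$ are finite for all $k$ and the following holds, with constants $C,C_0,C_1,C_2,C_3$ independent of $k$, for all $k\ge0$. 1) If $p=0$, $q>0$ and $$\alpha\gamma<\min\left\{\frac{2}{\mu+L},\ \frac{1-\rho_w^2}{4\sqrt2\,L\,d_I},\ \sqrt{\frac{2}{c_{42}+\sqrt{c_{42}^2+4c_{41}}}}\right\},$$ where $c_{41}=\frac{64(1+\rho_w^2)(3\mu+L)L^6d_I^2}{(1-\rho_w^2)^4(\mu+L)}$ and $c_{42}=\frac{64(1+\rho_w^2)(\mu+L+2L^2)L^2d_I^2}{(1-\rho_w^2)^4(\mu+L)}$ (for $n=1$, where $d_I=0$, the last two terms of the minimum are $+\infty$), then $U_k$, $X_k$ and $Y_k$ are all at most $\frac{C}{(m+k)^{2q}}$. 2) If $0<p\le1$, $q>p$ and $\alpha\gamma>\min\{2q-p,2p\}/\mu$, then $$U_k\le\frac{C_1}{(m+k)^{\min\{2q-p,2p\}}},\qquad X_k\le\frac{C_2}{(m+k)^{2\min\{q,p\}}},\qquad Y_k\le\frac{C_3}{(m+k)^{2\min\{q,p\}}}.$$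 3) If $p>1$ and $q\ge p/2$, then $$U_k\le C_0+\frac{C_1}{(m+k)^p},\qquad X_k\le\frac{C_2}{(m+k)^{2\min\{q,p\}}},\qquad Y_k\le\frac{C_3}{(m+k)^{2\min\{q,p\}}}.$$ -/

import Mathlib

open MeasureTheory ProbabilityTheory

namespace GradTrack

noncomputable section

/-- The space `ℝ^r` with its Euclidean norm. -/
abbrev Vec (r : ℕ) : Type := EuclideanSpace ℝ (Fin r)

/-! ### Inter-agent coupling -/

/-- The undirected communication graph induced by `W`: distinct agents `i`, `j` are adjacent iff
`w_ij > 0` (for symmetric `W`; self-loops are irrelevant for connectivity). -/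
def commGraph {n : ℕ} (W : Matrix (Fin n) (Fin n) ℝ) : SimpleGraph (Fin n) :=
  SimpleGraph.fromRel (fun i j => 0 < W i j)

/-- Assumption on the coupling matrix: nonnegative, doubly stochastic, symmetric, with positive
diagonal, and with a connected induced graph (in particular there is at least one agent). -/
structure IsCoupling {n : ℕ} (W : Matrix (Fin n) (Fin n) ℝ) : Prop where
  doublyStochastic : W ∈ doublyStochastic ℝ (Fin n)
  symm : W.IsSymm
  diag_pos : ∀ i, 0 < W i i
  connected : (commGraph W).Connected

/-- The averaging matrix `11ᵀ/n`. -/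
def avgMat (n : ℕ) : Matrix (Fin n) (Fin n) ℝ := Matrix.of fun _ _ => (1 : ℝ) / n

/-- `ρ_w`, the spectral radius of `W - 11ᵀ/n`. For symmetric `W` all eigenvalues are real, so the
spectrum over `ℝ` is the whole spectrum. -/
def rhoW {n : ℕ} (W : Matrix (Fin n) (Fin n) ℝ) : ℝ :=
  (spectralRadius ℝ (W - avgMat n)).toReal

/-- `d_I = ‖I - 11ᵀ/n‖₂`, where the norm of a matrix is the 2-norm of the vector of the 2-norms of
its columns (i.e. the square root of the sum of the squares of the entries). -/
def dI (n : ℕ) : ℝ :=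
  Real.sqrt (∑ i : Fin n, ∑ j : Fin n, ((1 : Matrix (Fin n) (Fin n) ℝ) - avgMat n) i j ^ 2)

/-! ### Objective functions -/

/-- Every `f_i` is differentiable, `μ`-strongly convex and has an `L`-Lipschitz gradient. -/
structure IsObjective {n r : ℕ} (f : Fin n → Vec r → ℝ) (μ L : ℝ) : Prop where
  differentiable : ∀ i, Differentiable ℝ (f i)
  strongly_convex : ∀ i x x',
    μ * ‖x - x'‖ ^ 2 ≤ inner ℝ (gradient (f i) x - gradient (f i) x') (x - x')
  lipschitz : ∀ i x x', ‖gradient (f i) x - gradient (f i) x'‖ ≤ L * ‖x - x'‖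

/-- `x` minimizes the global objective `(1/n) ∑ f_i` over `ℝ^r`. -/
def IsMinimizer {n r : ℕ} (f : Fin n → Vec r → ℝ) (x : Vec r) : Prop :=
  ∀ z, (1 / (n : ℝ)) * ∑ i, f i x ≤ (1 / (n : ℝ)) * ∑ i, f i z

/-! ### Noise -/

/-- `η k i` and `ξ k i` are the noises of agent `i` at iteration `k`. Their coordinates are
independent along iterations `k`, across agents `i` and across coordinates `j`; no independence
between `η` and `ξ` at one and the same index `(k, i, j)` is required. They have zero means, and
second moments at most `ση ^ 2` and `σξ ^ 2` at every iteration. -/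
structure IsNoise {n r : ℕ} {Ω : Type*} [MeasurableSpace Ω] (P : Measure Ω)
    (η ξ : ℕ → Fin n → Ω → Vec r) (ση σξ : ℝ) : Prop where
  measurable_eta : ∀ k i, Measurable (η k i)
  measurable_xi : ∀ k i, Measurable (ξ k i)
  indep : iIndepFun
    (fun (t : ℕ × Fin n × Fin r) (ω : Ω) =>
      ((η t.1 t.2.1 ω t.2.2, ξ t.1 t.2.1 ω t.2.2) : ℝ × ℝ)) P
  integrable_eta : ∀ k, Integrable (fun ω => ∑ i, ‖η k i ω‖ ^ 2) P
  integrable_xi : ∀ k, Integrable (fun ω => ∑ i, ‖ξ k i ω‖ ^ 2) P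
  mean_eta : ∀ k i, ∫ ω, η k i ω ∂P = 0
  mean_xi : ∀ k i, ∫ ω, ξ k i ω ∂P = 0
  variance_eta : ∀ k, ∫ ω, ∑ i, ‖η k i ω‖ ^ 2 ∂P ≤ ση ^ 2
  variance_xi : ∀ k, ∫ ω, ∑ i, ‖ξ k i ω‖ ^ 2 ∂P ≤ σξ ^ 2

/-! ### The algorithm -/

/-- `γ_k = γ / (m + k)^p`. -/
def stepSeq (γ m p : ℝ) (k : ℕ) : ℝ := γ / (m + k) ^ p

/-- `β_k = 1 / (m + k)^q`. -/
def noiseSeq (m q : ℝ) (k : ℕ) : ℝ := 1 / (m + k) ^ q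

/-- One update of the tracking variables:
`s_i ↦ w_ii s_i + ∑_{j ≠ i} w_ij (s_j + β η_j) + γ ∇f_i(x_i)`. -/
def nextS {n r : ℕ} (W : Matrix (Fin n) (Fin n) ℝ) (f : Fin n → Vec r → ℝ) (γ β : ℝ)
    (η s x : Fin n → Vec r) : Fin n → Vec r := fun i =>
  W i i • s i + ∑ j ∈ Finset.univ.erase i, W i j • (s j + β • η j) + γ • gradient (f i) (x i)

/-- One update of the decision variables, given the old and new tracking variables:
`x_i ↦ w_ii x_i + ∑_{j ≠ i} w_ij (x_j + β ξ_j) - α (s_i⁺ - s_i)`. -/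
def nextX {n r : ℕ} (W : Matrix (Fin n) (Fin n) ℝ) (α β : ℝ)
    (ξ s s' x : Fin n → Vec r) : Fin n → Vec r := fun i =>
  W i i • x i + ∑ j ∈ Finset.univ.erase i, W i j • (x j + β • ξ j) - α • (s' i - s i)

/-- The iterates `(s_k, x_k)` of the algorithm, for a given realization `η k i`, `ξ k i` of the
noise and given initial states. -/
def iterate {n r : ℕ} (W : Matrix (Fin n) (Fin n) ℝ) (f : Fin n → Vec r → ℝ) (α : ℝ)
    (γ β : ℕ → ℝ) (s₀ x₀ : Fin n → Vec r) (η ξ : ℕ → Fin n → Vec r) :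
    ℕ → (Fin n → Vec r) × (Fin n → Vec r)
  | 0 => (s₀, x₀)
  | k + 1 =>
    let s := (iterate W f α γ β s₀ x₀ η ξ k).1
    let x := (iterate W f α γ β s₀ x₀ η ξ k).2
    let s' := nextS W f (γ k) (β k) (η k) s x
    (s', nextX W α (β k) (ξ k) s s' x)

/-- The decision variables `x_k`. -/
def xIter {n r : ℕ} (W : Matrix (Fin n) (Fin n) ℝ) (f : Fin n → Vec r → ℝ) (α : ℝ)
    (γ β : ℕ → ℝ) (s₀ x₀ : Fin n → Vec r) (η ξ : ℕ → Fin n → Vec r) (k : ℕ) : Fin n → Vec r :=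
  (iterate W f α γ β s₀ x₀ η ξ k).2

/-- The increments `y_k = s_{k+1} - s_k`. -/
def yIter {n r : ℕ} (W : Matrix (Fin n) (Fin n) ℝ) (f : Fin n → Vec r → ℝ) (α : ℝ)
    (γ β : ℕ → ℝ) (s₀ x₀ : Fin n → Vec r) (η ξ : ℕ → Fin n → Vec r) (k : ℕ) : Fin n → Vec r :=
  fun i => (iterate W f α γ β s₀ x₀ η ξ (k + 1)).1 i - (iterate W f α γ β s₀ x₀ η ξ k).1 i

/-- The average `(1/n) ∑ z_i`. -/
def avg {n r : ℕ} (z : Fin n → Vec r) : Vec r := (1 / (n : ℝ)) • ∑ i, z i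

/-- The squared consensus error `‖z - 1 z̄‖² = ∑ ‖z_i - z̄‖²`. -/
def consErr {n r : ℕ} (z : Fin n → Vec r) : ℝ := ∑ i, ‖z i - avg z‖ ^ 2

/-- The random variable `Z` has a finite expectation, and it is at most `c`. -/
def MeanLE {Ω : Type*} [MeasurableSpace Ω] (P : Measure Ω) (Z : Ω → ℝ) (c : ℝ) : Prop :=
  Integrable Z P ∧ ∫ ω, Z ω ∂P ≤ c

/-- The three mean-square errors at iteration `k`, `E‖x̄_k - x*‖²`, `E‖x_k - 1 x̄_k‖²` and
`E‖y_k - 1 ȳ_k‖²`, are finite and bounded by `u`, `v` and `w`. -/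
def ErrorsLE {n r : ℕ} {Ω : Type*} [MeasurableSpace Ω] (P : Measure Ω)
    (W : Matrix (Fin n) (Fin n) ℝ) (f : Fin n → Vec r → ℝ) (α : ℝ) (γ β : ℕ → ℝ)
    (s₀ x₀ : Fin n → Vec r) (η ξ : ℕ → Fin n → Ω → Vec r) (xstar : Vec r)
    (k : ℕ) (u v w : ℝ) : Prop :=
  MeanLE P (fun ω => ‖avg (xIter W f α γ β s₀ x₀
    (fun l i => η l i ω) (fun l i => ξ l i ω) k) - xstar‖ ^ 2) u ∧
  MeanLE P (fun ω => consErr (xIter W f α γ β s₀ x₀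
    (fun l i => η l i ω) (fun l i => ξ l i ω) k)) v ∧
  MeanLE P (fun ω => consErr (yIter W f α γ β s₀ x₀
    (fun l i => η l i ω) (fun l i => ξ l i ω) k)) w

/-! ### The stepsize bound for constant stepsizes -/

/-- The constant `c₄₁`. -/
def c41 {n : ℕ} (W : Matrix (Fin n) (Fin n) ℝ) (μ L : ℝ) : ℝ :=
  64 * (1 + rhoW W ^ 2) * (3 * μ + L) * L ^ 6 * dI n ^ 2 / ((1 - rhoW W ^ 2) ^ 4 * (μ + L))

/-- The constant `c₄₂`. -/
def c42 {n : ℕ} (W : Matrix (Fin n) (Fin n) ℝ) (μ L : ℝ) : ℝ :=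
  64 * (1 + rhoW W ^ 2) * (μ + L + 2 * L ^ 2) * L ^ 2 * dI n ^ 2 /
    ((1 - rhoW W ^ 2) ^ 4 * (μ + L))

/-- `a` is smaller than each of `2 / (μ + L)`, `(1 - ρ_w²) / (4 √2 L d_I)` and
`√(2 / (c₄₂ + √(c₄₂² + 4 c₄₁)))`. The last two are cleared of denominators: these vanish for a
single agent (`d_I = 0`), where both quotients mean `+∞`. -/
def StepBound {n : ℕ} (W : Matrix (Fin n) (Fin n) ℝ) (μ L a : ℝ) : Prop :=
  a < 2 / (μ + L) ∧
  a * (4 * Real.sqrt 2 * L * dI n) < 1 - rhoW W ^ 2 ∧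
  a * Real.sqrt ((c42 W μ L + Real.sqrt (c42 W μ L ^ 2 + 4 * c41 W μ L)) / 2) < 1

end

end GradTrack

/-! Only three quantities matter: the averaged iterate, the deviations of the `x_i` from their mean
and the deviations of the `s_i` from theirs. The mean of `s` cancels from the `x`-update, because
`W` preserves averages; the averaged iterate therefore makes an inexact gradient step of length
`αγ_k`, disturbed by the consensus error alone. The deviations are contracted by `W` at rate `ρ_w <
1` and driven by the gradients.

The noise of iteration `k` enters additively, has mean zero and is independent of the state, which
is a function of earlier noise. Cross terms vanish in expectation, so every inequality for the
noise-free step that is affine in the three squared errors passes to the mean-square errors with an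
extra `O(β_k²)` (`error_recursion`).

For a constant step, the deviations of `s` do not tend to zero but to the solution `t` of `(I - W) t
= γ dev ∇f(x*)`. Measured from `t`, a weighted sum of the three errors contracts geometrically
(`lyap_contraction`): cocoercivity of the gradients pays for the gradient terms, strong convexity
gives the decay. A geometric contraction forced by `(m+k)^(-2q)` inherits that rate.

For decaying steps, `t = 0` is used and the whole gradient is a perturbation: the consensus and
tracking errors contract up to `O(γ_k²)(1 + errors)` (`exists_consensus_contraction`), the
optimality error by `1 - αγ_k μ` up to `O(γ_k)` times the consensus error (`dist_avg_meanX_le`). The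
sum of the errors is then bounded, by Chung's lemma for `p ≤ 1` and by summability for `p > 1`.
Boundedness gives the consensus rate; for `p ≤ 1` that rate, inserted into the optimality recursion,
gives by Chung's lemma (`exists_le_div_rpow`) the optimality rate.

The smallness of the step is needed only for large `k`, and finitely many initial terms go into the
constants, so `m = 1` always works. -/

namespace GradTrack

/-! ### Stacked vectors: averages, deviations and Young inequalities. -/

variable {n r : ℕ}

/-- The squared norm `∑ ‖z_i‖²` of a stacked vector. -/
noncomputable def sqn (z : Fin n → Vec r) : ℝ := ∑ i, ‖z i‖ ^ 2

/-- The deviations `z_i - z̄` from the average. -/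
noncomputable def dev (z : Fin n → Vec r) : Fin n → Vec r := fun i => z i - avg z

/-- The stacked vector `W z`. -/
noncomputable def mix (W : Matrix (Fin n) (Fin n) ℝ) (z : Fin n → Vec r) : Fin n → Vec r :=
  fun i => ∑ j, W i j • z j

/-- The stacked vector `W z` with the diagonal of `W` removed. -/
noncomputable def offMix (W : Matrix (Fin n) (Fin n) ℝ) (z : Fin n → Vec r) : Fin n → Vec r :=
  fun i => ∑ j ∈ Finset.univ.erase i, W i j • z j

lemma sqn_nonneg (z : Fin n → Vec r) : 0 ≤ sqn z := Finset.sum_nonneg fun _ _ => by positivity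

lemma consErr_eq (z : Fin n → Vec r) : consErr z = sqn (dev z) := rfl

lemma avg_add (z w : Fin n → Vec r) : avg (z + w) = avg z + avg w := by
  simp [avg, Finset.sum_add_distrib]

lemma avg_sub (z w : Fin n → Vec r) : avg (z - w) = avg z - avg w := by
  simp [avg, Finset.sum_sub_distrib, smul_sub]

lemma avg_smul (c : ℝ) (z : Fin n → Vec r) : avg (c • z) = c • avg z := by
  simp [avg, ← Finset.smul_sum, smul_comm c]

lemma dev_add (z w : Fin n → Vec r) : dev (z + w) = dev z + dev w := by
  ext1 i; simp only [dev, avg_add, Pi.add_apply]; abel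

lemma dev_sub (z w : Fin n → Vec r) : dev (z - w) = dev z - dev w := by
  ext1 i; simp only [dev, avg_sub, Pi.sub_apply]; abel

lemma dev_smul (c : ℝ) (z : Fin n → Vec r) : dev (c • z) = c • dev z := by
  ext1 i; simp only [dev, avg_smul, Pi.smul_apply, smul_sub]

lemma sum_eq_smul_avg [NeZero n] (z : Fin n → Vec r) : ∑ i, z i = (n : ℝ) • avg z := by
  have : (n : ℝ) ≠ 0 := by exact_mod_cast NeZero.ne n
  simp [avg, smul_smul, this]

lemma avg_const [NeZero n] (v : Vec r) : avg (fun _ : Fin n => v) = v := by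
  have : (n : ℝ) ≠ 0 := by exact_mod_cast NeZero.ne n
  simp [avg, ← Nat.cast_smul_eq_nsmul ℝ, smul_smul, this]

lemma avg_dev [NeZero n] (z : Fin n → Vec r) : avg (dev z) = 0 := by
  have h : dev z = z - fun _ => avg z := rfl
  rw [h, avg_sub, avg_const, sub_self]

lemma dev_const [NeZero n] (v : Vec r) : dev (fun _ : Fin n => v) = 0 := by
  ext1 i; simp [dev, avg_const]

/-- Consensus vectors and vectors of zero average are orthogonal complements, so the cross terms
drop out. -/
lemma sum_inner_eq [NeZero n] (z w : Fin n → Vec r) :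
    ∑ i, inner ℝ (z i) (w i)
      = n * inner ℝ (avg z) (avg w) + ∑ i, inner ℝ (dev z i) (dev w i) := by
  have h : ∀ i, inner ℝ (z i) (w i) = inner ℝ (avg z) (w i) + inner ℝ (dev z i) (avg w)
      + inner ℝ (dev z i) (dev w i) := fun i => by
    simp only [dev, inner_sub_left, inner_sub_right]; ring
  rw [Finset.sum_congr rfl fun i _ => h i, Finset.sum_add_distrib, Finset.sum_add_distrib,
    ← inner_sum, ← sum_inner, sum_eq_smul_avg w, sum_eq_smul_avg (dev z), avg_dev]
  simp [inner_smul_right]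

lemma sqn_eq [NeZero n] (z : Fin n → Vec r) : sqn z = n * ‖avg z‖ ^ 2 + sqn (dev z) := by
  have := sum_inner_eq z z
  simp only [real_inner_self_eq_norm_sq] at this
  exact this

lemma sqn_dev_le [NeZero n] (z : Fin n → Vec r) : sqn (dev z) ≤ sqn z := by
  rw [sqn_eq z]; have : 0 ≤ (n : ℝ) * ‖avg z‖ ^ 2 := by positivity
  linarith

lemma norm_avg_sq_le [NeZero n] (z : Fin n → Vec r) : n * ‖avg z‖ ^ 2 ≤ sqn z := by
  rw [sqn_eq z]; linarith [sqn_nonneg (dev z)]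

lemma sqn_smul (c : ℝ) (z : Fin n → Vec r) : sqn (c • z) = c ^ 2 * sqn z := by
  simp [sqn, norm_smul, mul_pow, Finset.mul_sum]

lemma norm_add_sq_le_young {E : Type*} [NormedAddCommGroup E] [InnerProductSpace ℝ E] (a b : E)
    {c : ℝ} (hc : 0 < c) : ‖a + b‖ ^ 2 ≤ (1 + c) * ‖a‖ ^ 2 + (1 + 1 / c) * ‖b‖ ^ 2 := by
  have h : 0 ≤ ‖c • a - b‖ ^ 2 / c := by positivity
  rw [norm_sub_sq_real, norm_smul, inner_smul_left, Real.norm_eq_abs, abs_of_pos hc] at h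
  simp only [conj_trivial] at h
  rw [norm_add_sq_real]
  have : ((c * ‖a‖) ^ 2 - 2 * (c * inner ℝ a b) + ‖b‖ ^ 2) / c
      = c * ‖a‖ ^ 2 - 2 * inner ℝ a b + 1 / c * ‖b‖ ^ 2 := by field_simp
  rw [this] at h
  linarith

lemma sqn_add_le (z w : Fin n → Vec r) {c : ℝ} (hc : 0 < c) :
    sqn (z + w) ≤ (1 + c) * sqn z + (1 + 1 / c) * sqn w := by
  simp only [sqn, Finset.mul_sum, ← Finset.sum_add_distrib]
  exact Finset.sum_le_sum fun i _ => norm_add_sq_le_young _ _ hc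

lemma sqn_sub_le (z w : Fin n → Vec r) {c : ℝ} (hc : 0 < c) :
    sqn (z - w) ≤ (1 + c) * sqn z + (1 + 1 / c) * sqn w := by
  have := sqn_add_le z ((-1 : ℝ) • w) hc
  rw [sqn_smul] at this
  simpa [sub_eq_add_neg] using this

lemma two_sum_inner_le (z w : Fin n → Vec r) {c : ℝ} (hc : 0 < c) :
    2 * ∑ i, inner ℝ (z i) (w i) ≤ c * sqn z + 1 / c * sqn w := by
  simp only [sqn, Finset.mul_sum, ← Finset.sum_add_distrib]
  refine Finset.sum_le_sum fun i _ => ?_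
  have h : 0 ≤ ‖c • z i - w i‖ ^ 2 / c := by positivity
  rw [norm_sub_sq_real, norm_smul, inner_smul_left, Real.norm_eq_abs, abs_of_pos hc] at h
  simp only [conj_trivial] at h
  have : ((c * ‖z i‖) ^ 2 - 2 * (c * inner ℝ (z i) (w i)) + ‖w i‖ ^ 2) / c
      = c * ‖z i‖ ^ 2 - 2 * inner ℝ (z i) (w i) + 1 / c * ‖w i‖ ^ 2 := by field_simp
  rw [this] at h
  linarith

/-- Young's inequality with the weights that are optimal for a contraction by `ρ`. -/
lemma sqn_add_le_of_contraction {z w : Fin n → Vec r} {ρ S : ℝ} (h0 : 0 ≤ ρ) (h1 : ρ < 1)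
    (hz : sqn z ≤ ρ ^ 2 * S) : sqn (z + w) ≤ ρ * S + sqn w / (1 - ρ) := by
  -- The optimal Young weight `(1 - ρ) / ρ` is meaningless for `ρ = 0`, where `z` itself vanishes.
  rcases h0.eq_or_lt with rfl | h0
  · have hz0 : sqn z = 0 := le_antisymm (by simpa using hz) (sqn_nonneg z)
    have hz' : z = 0 := by
      ext1 i
      have := (Finset.sum_eq_zero_iff_of_nonneg (fun i _ => by positivity)).1 hz0 i
        (Finset.mem_univ i)
      simpa using this
    simp [hz']
  · have h1' : 0 < 1 - ρ := by linarith
    have := sqn_add_le z w (c := (1 - ρ) / ρ) (by positivity)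
    have e1 : 1 + (1 - ρ) / ρ = 1 / ρ := by field_simp; ring
    have e2 : 1 + 1 / ((1 - ρ) / ρ) = 1 / (1 - ρ) := by field_simp; ring
    rw [e1, e2] at this
    have h2 : 1 / ρ * sqn z ≤ 1 / ρ * (ρ ^ 2 * S) := by gcongr
    have e3 : 1 / ρ * (ρ ^ 2 * S) = ρ * S := by field_simp
    rw [e3] at h2
    rw [div_eq_mul_one_div, mul_comm (sqn w)]
    linarith

/-! ### The action of `W` on stacked vectors. -/

lemma mix_add (W : Matrix (Fin n) (Fin n) ℝ) (z w : Fin n → Vec r) :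
    mix W (z + w) = mix W z + mix W w := by
  ext1 i; simp [mix, Finset.sum_add_distrib]

lemma mix_sub (W : Matrix (Fin n) (Fin n) ℝ) (z w : Fin n → Vec r) :
    mix W (z - w) = mix W z - mix W w := by
  ext1 i; simp [mix, Finset.sum_sub_distrib, smul_sub]

lemma mix_smul (W : Matrix (Fin n) (Fin n) ℝ) (c : ℝ) (z : Fin n → Vec r) :
    mix W (c • z) = c • mix W z := by
  ext1 i; simp [mix, Finset.smul_sum, smul_comm c]

lemma mix_eq_offMix (W : Matrix (Fin n) (Fin n) ℝ) (z : Fin n → Vec r) (i : Fin n) :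
    mix W z i = W i i • z i + offMix W z i := by
  simp only [mix, offMix, Finset.add_sum_erase _ (fun j => W i j • z j) (Finset.mem_univ i)]

lemma avg_mix {W : Matrix (Fin n) (Fin n) ℝ} (hW : IsCoupling W) (z : Fin n → Vec r) :
    avg (mix W z) = avg z := by
  have h := (mem_doublyStochastic_iff_sum.1 hW.doublyStochastic).2.2
  simp only [avg, mix]
  rw [Finset.sum_comm]
  simp [← Finset.sum_smul, h]

lemma mix_const {W : Matrix (Fin n) (Fin n) ℝ} (hW : IsCoupling W) (v : Vec r) :
    mix W (fun _ => v) = fun _ => v := by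
  have h := (mem_doublyStochastic_iff_sum.1 hW.doublyStochastic).2.1
  ext1 i
  simp [mix, ← Finset.sum_smul, h]

lemma dev_mix {W : Matrix (Fin n) (Fin n) ℝ} (hW : IsCoupling W) (z : Fin n → Vec r) :
    dev (mix W z) = mix W (dev z) := by
  have h : dev z = z - fun _ => avg z := rfl
  rw [h, mix_sub, mix_const hW]
  ext1 i
  simp [dev, avg_mix hW]

lemma neZero_of_isCoupling {W : Matrix (Fin n) (Fin n) ℝ} (hW : IsCoupling W) : NeZero n := by
  obtain ⟨i⟩ := hW.connected.nonempty
  exact ⟨by rintro rfl; exact i.elim0⟩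

/-- A crude constant suffices: it only multiplies the noise variance. -/
lemma sqn_offMix_le {W : Matrix (Fin n) (Fin n) ℝ} (hW : IsCoupling W) (z : Fin n → Vec r) :
    sqn (offMix W z) ≤ n ^ 2 * sqn z := by
  obtain ⟨hn, hr, -⟩ := mem_doublyStochastic_iff_sum.1 hW.doublyStochastic
  have hle : ∀ i j, W i j ≤ 1 := fun i j => by
    rw [← hr i]; exact Finset.single_le_sum (fun k _ => hn i k) (Finset.mem_univ j)
  have h : ∀ i, ‖offMix W z i‖ ^ 2 ≤ n * sqn z := fun i => by
    have h1 : ‖offMix W z i‖ ≤ ∑ j, ‖z j‖ := by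
      refine (norm_sum_le _ _).trans ?_
      refine (Finset.sum_le_sum_of_subset_of_nonneg (Finset.erase_subset _ _)
        fun _ _ _ => norm_nonneg _).trans ?_
      refine Finset.sum_le_sum fun j _ => ?_
      rw [norm_smul, Real.norm_of_nonneg (hn i j)]
      exact mul_le_of_le_one_left (norm_nonneg _) (hle i j)
    calc ‖offMix W z i‖ ^ 2 ≤ (∑ j, ‖z j‖) ^ 2 := by gcongr
      _ ≤ n * sqn z := by
        simpa [sqn] using sq_sum_le_card_mul_sum_sq (s := Finset.univ) (f := fun j => ‖z j‖)
  calc sqn (offMix W z) ≤ ∑ _i : Fin n, n * sqn z := Finset.sum_le_sum fun i _ => h i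
    _ = n ^ 2 * sqn z := by simp; ring

lemma nextS_eq (W : Matrix (Fin n) (Fin n) ℝ) (f : Fin n → Vec r → ℝ) (γ β : ℝ)
    (η s x : Fin n → Vec r) :
    nextS W f γ β η s x
      = mix W s + γ • (fun i => gradient (f i) (x i)) + β • offMix W η := by
  ext1 i
  simp only [nextS, Pi.add_apply, Pi.smul_apply, mix_eq_offMix, offMix, smul_add,
    Finset.sum_add_distrib, smul_comm _ β, ← Finset.smul_sum]
  abel

lemma nextX_eq (W : Matrix (Fin n) (Fin n) ℝ) (α β : ℝ) (ξ s s' x : Fin n → Vec r) :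
    nextX W α β ξ s s' x = mix W x + β • offMix W ξ - α • (s' - s) := by
  ext1 i
  simp only [nextX, Pi.add_apply, Pi.sub_apply, Pi.smul_apply, mix_eq_offMix, offMix, smul_add,
    Finset.sum_add_distrib, smul_comm _ β, ← Finset.smul_sum]
  abel

/-! ### The spectral gap of `W`. -/

lemma isHermitian_sub_avgMat {W : Matrix (Fin n) (Fin n) ℝ} (hW : IsCoupling W) :
    (W - avgMat n).IsHermitian := by
  have h : W.transpose = W := hW.symm
  ext i j
  have := congrFun (congrFun h i) j
  simp only [Matrix.transpose_apply] at this
  simp [avgMat, this]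

/-- The spectral radius of a self-adjoint operator is its norm; this turns `ρ_w` into a contraction
factor. -/
lemma spectralRadius_eq {W : Matrix (Fin n) (Fin n) ℝ} (hW : IsCoupling W) :
    spectralRadius ℝ (W - avgMat n)
      = ‖Matrix.toEuclideanCLM (n := Fin n) (𝕜 := ℝ) (W - avgMat n)‖₊ := by
  rw [← ContinuousLinearMap.spectralRadius_eq_nnnorm (𝕜 := ℝ)]
  · simp only [spectralRadius]
    rw [AlgEquiv.spectrum_eq]
  · exact IsSelfAdjoint.map (isHermitian_sub_avgMat hW) _

lemma rhoW_eq {W : Matrix (Fin n) (Fin n) ℝ} (hW : IsCoupling W) :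
    rhoW W = ‖Matrix.toEuclideanCLM (n := Fin n) (𝕜 := ℝ) (W - avgMat n)‖ := by
  simp [rhoW, spectralRadius_eq hW]

lemma rhoW_nonneg (W : Matrix (Fin n) (Fin n) ℝ) : 0 ≤ rhoW W := ENNReal.toReal_nonneg

lemma sum_sq_mulVec_le {W : Matrix (Fin n) (Fin n) ℝ} (hW : IsCoupling W) (v : Fin n → ℝ) :
    ∑ i, ((W - avgMat n).mulVec v i) ^ 2 ≤ rhoW W ^ 2 * ∑ i, v i ^ 2 := by
  have h := (Matrix.toEuclideanCLM (n := Fin n) (𝕜 := ℝ) (W - avgMat n)).le_opNorm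
    (WithLp.toLp 2 v)
  rw [← rhoW_eq hW] at h
  have h2 := pow_le_pow_left₀ (norm_nonneg _) h 2
  rw [mul_pow, EuclideanSpace.norm_sq_eq, EuclideanSpace.norm_sq_eq] at h2
  simpa [Matrix.sub_mulVec] using h2

lemma sqn_eq_sum_coord (z : Fin n → Vec r) : sqn z = ∑ c, ∑ i, z i c ^ 2 := by
  rw [Finset.sum_comm]
  simp [sqn, EuclideanSpace.norm_sq_eq]

/-- On vectors of zero average `W` agrees with `W - 11ᵀ/n`, whose operator norm is `ρ_w`; this is
applied to each of the `r` coordinates. -/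
lemma sqn_mix_le {W : Matrix (Fin n) (Fin n) ℝ} (hW : IsCoupling W) {z : Fin n → Vec r}
    (hz : avg z = 0) : sqn (mix W z) ≤ rhoW W ^ 2 * sqn z := by
  have key : ∀ c i, mix W z i c = (W - avgMat n).mulVec (fun j => z j c) i := fun c i => by
    have h0 : ∑ j, 1 / (n : ℝ) * z j c = 0 := by
      have := congrArg (fun v : Vec r => v c) hz
      simpa [avg, Finset.mul_sum] using this
    simp only [Matrix.mulVec, dotProduct, avgMat, Matrix.of_apply, Matrix.sub_apply, sub_mul,
      Finset.sum_sub_distrib, h0, sub_zero]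
    simp [mix]
  rw [sqn_eq_sum_coord, sqn_eq_sum_coord, Finset.mul_sum]
  refine Finset.sum_le_sum fun c _ => ?_
  simp only [key]
  exact sum_sq_mulVec_le hW _

/-- Quadratic form identities behind `|λ| < 1`. -/
lemma sum_mul_add_sq {W : Matrix (Fin n) (Fin n) ℝ} (hW : IsCoupling W) (v : Fin n → ℝ) (c : ℝ) :
    ∑ i, ∑ j, W i j * (v i + c * v j) ^ 2
      = (1 + c ^ 2) * ∑ i, v i ^ 2 + 2 * c * ∑ i, v i * W.mulVec v i := by
  obtain ⟨-, hr, hc⟩ := mem_doublyStochastic_iff_sum.1 hW.doublyStochastic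
  have h1 : ∑ i, ∑ j, W i j * v i ^ 2 = ∑ i, v i ^ 2 := by
    simp [← Finset.sum_mul, hr]
  have h2 : ∑ i, ∑ j, W i j * v j ^ 2 = ∑ i, v i ^ 2 := by
    rw [Finset.sum_comm]; simp [← Finset.sum_mul, hc]
  have h3 : ∑ i, ∑ j, W i j * (v i * v j) = ∑ i, v i * W.mulVec v i := by
    refine Finset.sum_congr rfl fun i _ => ?_
    simp only [Matrix.mulVec, dotProduct, Finset.mul_sum]
    exact Finset.sum_congr rfl fun j _ => by ring
  have h4 : ∀ i j, W i j * (v i + c * v j) ^ 2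
      = W i j * v i ^ 2 + c ^ 2 * (W i j * v j ^ 2) + 2 * c * (W i j * (v i * v j)) :=
    fun i j => by ring
  simp only [h4, Finset.sum_add_distrib, ← Finset.mul_sum, h1, h2, h3]
  ring

/-- All summands are nonnegative, so each vanishes; `v` is constant along edges, hence along walks,
hence everywhere by connectedness. -/
lemma eq_of_quadForm_eq {W : Matrix (Fin n) (Fin n) ℝ} (hW : IsCoupling W) {v : Fin n → ℝ}
    (h : ∑ i, ∑ j, W i j * (v i + (-1) * v j) ^ 2 ≤ 0) (i j : Fin n) : v i = v j := by
  have hn := (mem_doublyStochastic_iff_sum.1 hW.doublyStochastic).1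
  have hadj : ∀ a b, (commGraph W).Adj a b → v a = v b := by
    intro a b hab
    have hpos : 0 < W a b := by
      rcases hab.2 with h | h
      · exact h
      · have : W b a = W a b := congrFun (congrFun hW.symm a) b
        exact this ▸ h
    have h1 : W a b * (v a + (-1) * v b) ^ 2 ≤ 0 := by
      refine le_trans ?_ h
      refine le_trans ?_ (Finset.single_le_sum (f := fun i => ∑ j, W i j * (v i + (-1) * v j) ^ 2)
        (fun i _ => Finset.sum_nonneg fun j _ => mul_nonneg (hn i j) (sq_nonneg _))
        (Finset.mem_univ a))
      exact Finset.single_le_sum (f := fun j => W a j * (v a + (-1) * v j) ^ 2)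
        (fun j _ => mul_nonneg (hn a j) (sq_nonneg _)) (Finset.mem_univ b)
    have h2 : (v a + (-1) * v b) ^ 2 = 0 :=
      le_antisymm (nonpos_of_mul_nonpos_right h1 hpos) (sq_nonneg _)
    have := pow_eq_zero_iff (two_ne_zero) |>.1 h2
    linarith
  obtain ⟨p⟩ := hW.connected.preconnected i j
  induction p with
  | nil => rfl
  | cons hab _ ih => exact (hadj _ _ hab).trans ih

/-- An eigenvector for `l ≠ 0` has zero sum, so it is an eigenvector of `W`, and `∑ w_ij (v_i ±
v_j)² = 2 (1 ± l) ∑ v_i²`. The positive diagonal rules out `l ≤ -1`; connectedness together with the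
zero sum rules out `l ≥ 1`. -/
lemma abs_lt_one_of_eigenvector {W : Matrix (Fin n) (Fin n) ℝ} (hW : IsCoupling W)
    {v : Fin n → ℝ} (hv : v ≠ 0) {l : ℝ} (hl : (W - avgMat n).mulVec v = l • v) : |l| < 1 := by
  have := neZero_of_isCoupling hW
  have hn0 : (n : ℝ) ≠ 0 := by exact_mod_cast NeZero.ne n
  obtain ⟨hn, hr, hc⟩ := mem_doublyStochastic_iff_sum.1 hW.doublyStochastic
  by_cases hl0 : l = 0
  · simp [hl0]
  have hA : ∀ i, (W - avgMat n).mulVec v i = W.mulVec v i - 1 / n * ∑ j, v j := fun i => by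
    simp [Matrix.mulVec, dotProduct, avgMat, Finset.mul_sum, sub_mul]
  have hsumW : ∑ i, W.mulVec v i = ∑ j, v j := by
    simp only [Matrix.mulVec, dotProduct]
    rw [Finset.sum_comm]
    simp [← Finset.sum_mul, hc]
  -- The columns of `W - 11ᵀ/n` sum to zero, so `l ∑ v_j = 0`.
  have hs : ∑ j, v j = 0 := by
    have h1 : ∑ i, (W - avgMat n).mulVec v i = l * ∑ i, v i := by
      rw [hl]; simp [Finset.mul_sum]
    simp only [hA, Finset.sum_sub_distrib, hsumW] at h1
    simp [hn0] at h1
    exact h1.resolve_left hl0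
  have hWv : ∀ i, W.mulVec v i = l * v i := fun i => by
    have := congrFun hl i
    rw [hA, hs] at this
    simpa using this
  have hq : ∑ i, v i * W.mulVec v i = l * ∑ i, v i ^ 2 := by
    rw [Finset.mul_sum]
    exact Finset.sum_congr rfl fun i _ => by rw [hWv]; ring
  have hpos : 0 < ∑ i, v i ^ 2 := by
    obtain ⟨i, hi⟩ := Function.ne_iff.1 hv
    exact Finset.sum_pos' (fun i _ => sq_nonneg _) ⟨i, Finset.mem_univ i, by
      have : v i ≠ 0 := hi
      positivity⟩
  have hplus := sum_mul_add_sq hW v 1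
  have hminus := sum_mul_add_sq hW v (-1)
  rw [hq] at hplus hminus
  refine abs_lt.2 ⟨?_, ?_⟩
  · by_contra! hle
    have h0 : ∑ i, ∑ j, W i j * (v i + 1 * v j) ^ 2 ≤ 0 := by
      rw [hplus]; nlinarith
    obtain ⟨i, hi⟩ := Function.ne_iff.1 hv
    have h1 : W i i * (v i + 1 * v i) ^ 2 ≤ 0 := by
      refine le_trans ?_ h0
      refine le_trans ?_ (Finset.single_le_sum (f := fun i => ∑ j, W i j * (v i + 1 * v j) ^ 2)
        (fun i _ => Finset.sum_nonneg fun j _ => mul_nonneg (hn i j) (sq_nonneg _))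
        (Finset.mem_univ i))
      exact Finset.single_le_sum (f := fun j => W i j * (v i + 1 * v j) ^ 2)
        (fun j _ => mul_nonneg (hn i j) (sq_nonneg _)) (Finset.mem_univ i)
    have h2 : v i + 1 * v i ≠ 0 := by
      intro h; exact hi (by simp only [Pi.zero_apply]; linarith)
    have := hW.diag_pos i
    have : 0 < W i i * (v i + 1 * v i) ^ 2 := by positivity
    linarith
  · by_contra! hle
    have h0 : ∑ i, ∑ j, W i j * (v i + (-1) * v j) ^ 2 ≤ 0 := by
      rw [hminus]; nlinarith
    obtain ⟨i, hi⟩ := Function.ne_iff.1 hv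
    have h1 : ∑ j, v j = n * v i := by
      rw [Finset.sum_congr rfl fun j _ => eq_of_quadForm_eq hW h0 j i]; simp
    rw [hs] at h1
    exact hi ((mul_eq_zero.1 h1.symm).resolve_left hn0)

lemma rhoW_lt_one {W : Matrix (Fin n) (Fin n) ℝ} (hW : IsCoupling W) : rhoW W < 1 := by
  have := neZero_of_isCoupling hW
  have hA := isHermitian_sub_avgMat hW
  have hlt : ∀ i, ‖hA.eigenvalues i‖₊ < 1 := fun i => by
    have h := abs_lt_one_of_eigenvector hW (v := ⇑(hA.eigenvectorBasis i)) (l := hA.eigenvalues i)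
      (fun h => hA.eigenvectorBasis.orthonormal.ne_zero i (by ext j; exact congrFun h j))
      (hA.mulVec_eigenvectorBasis i)
    rw [← Real.norm_eq_abs] at h
    exact_mod_cast h
  obtain ⟨i, hi⟩ := Finite.exists_max fun i => ‖hA.eigenvalues i‖₊
  have hle : spectralRadius ℝ (W - avgMat n) ≤ (‖hA.eigenvalues i‖₊ : ENNReal) := by
    refine iSup₂_le fun x hx => ?_
    rw [hA.spectrum_real_eq_range_eigenvalues] at hx
    obtain ⟨j, rfl⟩ := hx
    exact_mod_cast hi j
  have h2 := ENNReal.toReal_mono ENNReal.coe_ne_top hle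
  have h3 : ‖hA.eigenvalues i‖ < 1 := by exact_mod_cast hlt i
  simpa [rhoW] using lt_of_le_of_lt h2 h3

/-- On zero averages `I - W` has norm at most `1 + ρ`. The Young weight `(1 - ρ) / (1 + ρ)` trades
one factor `1 + ρ` for a `2`. -/
lemma sqn_sub_mix_le {W : Matrix (Fin n) (Fin n) ℝ} (hW : IsCoupling W) {z w : Fin n → Vec r}
    (hz : avg z = 0) :
    sqn (z - mix W z - w)
      ≤ 2 * (1 + rhoW W) * sqn z + 2 / (1 - rhoW W) * sqn w := by
  set ρ := rhoW W
  have h0 : 0 ≤ ρ := rhoW_nonneg W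
  have h1 : 0 < 1 - ρ := by have : ρ < 1 := rhoW_lt_one hW; linarith
  have ha : sqn (z - mix W z) ≤ (1 + ρ) ^ 2 * sqn z := by
    rcases h0.eq_or_lt with h | h
    · have hm := sqn_mix_le hW hz
      change _ ≤ ρ ^ 2 * _ at hm
      rw [← h] at hm ⊢
      have hz0 : sqn (mix W z) = 0 := le_antisymm (by simpa using hm) (sqn_nonneg _)
      have hz' : mix W z = 0 := by
        ext1 i
        have := (Finset.sum_eq_zero_iff_of_nonneg (fun i _ => by positivity)).1 hz0 i
          (Finset.mem_univ i)
        simpa using this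
      simp [hz']
    · have hm : sqn (mix W z) ≤ ρ ^ 2 * sqn z := sqn_mix_le hW hz
      have h2 := sqn_sub_le z (mix W z) h
      have h3 : (1 + 1 / ρ) * sqn (mix W z) ≤ (1 + 1 / ρ) * (ρ ^ 2 * sqn z) := by gcongr
      have h4 : (1 + 1 / ρ) * (ρ ^ 2 * sqn z) = (ρ + ρ ^ 2) * sqn z := by field_simp; ring
      linarith
  have hb := sqn_sub_le (z - mix W z) w (c := (1 - ρ) / (1 + ρ)) (by positivity)
  have e1 : 1 + (1 - ρ) / (1 + ρ) = 2 / (1 + ρ) := by field_simp; ring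
  have e2 : 1 + 1 / ((1 - ρ) / (1 + ρ)) = 2 / (1 - ρ) := by field_simp; ring
  rw [e1, e2] at hb
  have h5 : 2 / (1 + ρ) * sqn (z - mix W z) ≤ 2 / (1 + ρ) * ((1 + ρ) ^ 2 * sqn z) := by gcongr
  have h6 : 2 / (1 + ρ) * ((1 + ρ) ^ 2 * sqn z) = 2 * (1 + ρ) * sqn z := by field_simp
  linarith

/-! ### Strong convexity and smoothness combined into one inequality. -/

section Sector

variable {E : Type*} [NormedAddCommGroup E] [InnerProductSpace ℝ E] [CompleteSpace E]

/-- The descent lemma. -/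
lemma le_quadratic_of_inner_le {φ : E → ℝ} {G : E → E} {M : ℝ}
    (hφ : ∀ x, HasGradientAt φ (G x) x)
    (hG : ∀ x y, inner ℝ (G x - G y) (x - y) ≤ M * ‖x - y‖ ^ 2) (x z : E) :
    φ z ≤ φ x + inner ℝ (G x) (z - x) + M / 2 * ‖z - x‖ ^ 2 := by
  set d := z - x with hd
  -- `ψ` is `φ` on the segment minus its quadratic model; the hypothesis on `G` makes it
  -- nonincreasing, and the claim is `ψ 1 ≤ ψ 0`.
  let ψ : ℝ → ℝ := fun t => φ (x + t • d) - t * inner ℝ (G x) d - M / 2 * ‖d‖ ^ 2 * t ^ 2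
  have hψ : ∀ t, HasDerivAt ψ
      (inner ℝ (G (x + t • d)) d - inner ℝ (G x) d - M / 2 * ‖d‖ ^ 2 * (2 * t)) t := fun t => by
    have h1 : HasDerivAt (fun t : ℝ => x + t • d) d t := by
      simpa using ((hasDerivAt_id t).smul_const d).const_add x
    have h2 := (hφ (x + t • d)).hasFDerivAt.comp_hasDerivAt t h1
    have h3 := (hasDerivAt_id t).mul_const (inner ℝ (G x) d)
    have h4 := ((hasDerivAt_pow 2 t).const_mul (M / 2 * ‖d‖ ^ 2))
    have h5 := (h2.sub h3).sub h4
    refine h5.congr_deriv ?_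
    simp
  have hanti : AntitoneOn ψ (Set.Icc 0 1) := by
    refine antitoneOn_of_deriv_nonpos (convex_Icc 0 1)
      (fun t _ => (hψ t).continuousAt.continuousWithinAt)
      (fun t _ => (hψ t).differentiableAt.differentiableWithinAt) fun t ht => ?_
    rw [interior_Icc] at ht
    rw [(hψ t).deriv]
    have h := hG (x + t • d) x
    rw [add_sub_cancel_left, inner_smul_right, norm_smul, Real.norm_of_nonneg ht.1.le,
      inner_sub_left] at h
    have h2 : t * (inner ℝ (G (x + t • d)) d - inner ℝ (G x) d) ≤ t * (M * t * ‖d‖ ^ 2) := by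
      calc _ ≤ _ := h
        _ = _ := by ring
    have := le_of_mul_le_mul_left h2 ht.1
    linarith
  have h := hanti (Set.left_mem_Icc.2 zero_le_one) (Set.right_mem_Icc.2 zero_le_one) zero_le_one
  simp only [ψ, zero_smul, one_smul, add_zero, hd, add_sub_cancel] at h
  norm_num at h
  linarith

/-- The sector inequality for gradients of strongly convex functions with Lipschitz gradient. -/
lemma sector_inequality {φ : E → ℝ} {G : E → E} {μ L : ℝ} (hμL : μ ≤ L)
    (hφ : ∀ x, HasGradientAt φ (G x) x)
    (hμ : ∀ x y, μ * ‖x - y‖ ^ 2 ≤ inner ℝ (G x - G y) (x - y))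
    (hL : ∀ x y, ‖G x - G y‖ ≤ L * ‖x - y‖) (h0 : 0 ≤ μ) (x y : E) :
    μ * L * ‖x - y‖ ^ 2 + ‖G x - G y‖ ^ 2 ≤ (μ + L) * inner ℝ (G x - G y) (x - y) := by
  -- The main argument divides by `L - μ`.
  rcases hμL.eq_or_lt with rfl | hlt
  · have h1 := pow_le_pow_left₀ (norm_nonneg _) (hL x y) 2
    have h2 := mul_le_mul_of_nonneg_left (hμ x y) h0
    nlinarith
  have hup := le_quadratic_of_inner_le (M := L) hφ fun x y =>
    (real_inner_le_norm _ _).trans (by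
      have := mul_le_mul_of_nonneg_right (hL x y) (norm_nonneg (x - y))
      nlinarith)
  have hlow := le_quadratic_of_inner_le (φ := fun x => -φ x) (G := fun x => -G x) (M := -μ)
    (fun x => by
      have := (hφ x).hasFDerivAt.neg
      rw [hasGradientAt_iff_hasFDerivAt, map_neg]
      exact this)
    fun x y => by
      have : -G x - -G y = -(G x - G y) := by abel
      rw [this, inner_neg_left]
      linarith [hμ x y]
  have hM : 0 < L - μ := by linarith
  -- The function `φ - μ/2 ‖·‖²` is convex and `(L - μ)`-smooth. The upper model at `y` and the
  -- lower model at `x` are compared at `y + e`; the gap `-⟨δ, e⟩ - (L - μ)/2 ‖e‖²` is largest at `e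
  -- = -δ / (L - μ)`. Adding the two versions with `x` and `y` exchanged removes the values of `φ`.
  have key : ∀ x y : E, μ / 2 * ‖y - x‖ ^ 2
      + ‖G y - G x - μ • (y - x)‖ ^ 2 / (2 * (L - μ)) ≤ φ y - φ x - inner ℝ (G x) (y - x) := by
    intro x y
    set δ := G y - G x - μ • (y - x) with hδ
    set e : E := -((1 / (L - μ)) • δ) with he
    have h1 := hup y (y + e)
    have h2 := hlow x (y + e)
    rw [add_sub_cancel_left] at h1
    have h3 : y + e - x = (y - x) + e := by abel
    rw [h3, norm_add_sq_real, inner_neg_left, inner_add_right] at h2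
    have h4 : inner ℝ (G y) e = inner ℝ (G x) e + μ * inner ℝ (y - x) e + inner ℝ δ e := by
      have : G y = G x + μ • (y - x) + δ := by rw [hδ]; abel
      conv_lhs => rw [this]
      rw [inner_add_left, inner_add_left, inner_smul_left]; simp
    have h5 : inner ℝ δ e = -(‖δ‖ ^ 2 / (L - μ)) := by
      rw [he, inner_neg_right, inner_smul_right, real_inner_self_eq_norm_sq]; ring
    have h6 : ‖e‖ ^ 2 = ‖δ‖ ^ 2 / (L - μ) ^ 2 := by
      rw [he, norm_neg, norm_smul, Real.norm_of_nonneg (by positivity)]; field_simp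
    have h7 : (L - μ) / 2 * ‖e‖ ^ 2 = ‖δ‖ ^ 2 / (2 * (L - μ)) := by
      rw [h6]; field_simp
    have h8 : ‖δ‖ ^ 2 / (L - μ) = 2 * (‖δ‖ ^ 2 / (2 * (L - μ))) := by field_simp
    rw [h4, h5, h8] at h1
    nlinarith
  have k1 := key x y
  have k2 := key y x
  have e1 : G x - G y - μ • (x - y) = -(G y - G x - μ • (y - x)) := by
    rw [smul_sub, smul_sub]; abel
  rw [e1, norm_neg] at k2
  have e2 : inner ℝ (G x - G y) (x - y) = - inner ℝ (G x) (y - x) - inner ℝ (G y) (x - y) := by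
    have : x - y = -(y - x) := by abel
    rw [this]
    simp only [inner_sub_left, inner_neg_right]; ring
  have e3 : ‖y - x‖ = ‖x - y‖ := norm_sub_rev _ _
  have e4 : G y - G x - μ • (y - x) = -((G x - G y) - μ • (x - y)) := by
    rw [smul_sub, smul_sub]; abel
  have e5 : ‖(G x - G y) - μ • (x - y)‖ ^ 2 = ‖G x - G y‖ ^ 2
      - 2 * (μ * inner ℝ (G x - G y) (x - y)) + (μ * ‖x - y‖) ^ 2 := by
    rw [norm_sub_sq_real, inner_smul_right, norm_smul, Real.norm_of_nonneg h0]
  rw [e4, norm_neg, e5] at k1 k2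
  rw [e3] at k1
  set p := ‖x - y‖
  set q := ‖G x - G y‖
  set s := inner ℝ (G x - G y) (x - y)
  have hsum : μ * p ^ 2 + (q ^ 2 - 2 * (μ * s) + (μ * p) ^ 2) / (L - μ) ≤ s := by
    have : (q ^ 2 - 2 * (μ * s) + (μ * p) ^ 2) / (L - μ)
        = 2 * ((q ^ 2 - 2 * (μ * s) + (μ * p) ^ 2) / (2 * (L - μ))) := by field_simp
    rw [this]; linarith
  have h9 := mul_le_mul_of_nonneg_left hsum hM.le
  have h10 : (L - μ) * (μ * p ^ 2 + (q ^ 2 - 2 * (μ * s) + (μ * p) ^ 2) / (L - μ))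
      = (L - μ) * (μ * p ^ 2) + (q ^ 2 - 2 * (μ * s) + (μ * p) ^ 2) := by
    field_simp
  rw [h10] at h9
  nlinarith

end Sector

/-! ### The noise-free step and its error estimates. -/

/-- The stacked gradients `∇f_i(x_i)`. -/
noncomputable def stackGrad (f : Fin n → Vec r → ℝ) (x : Fin n → Vec r) : Fin n → Vec r :=
  fun i => gradient (f i) (x i)

/-- The noise-free update of the tracking variables. -/
noncomputable def meanS (W : Matrix (Fin n) (Fin n) ℝ) (f : Fin n → Vec r → ℝ) (γ : ℝ)
    (s x : Fin n → Vec r) : Fin n → Vec r := mix W s + γ • stackGrad f x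

/-- The noise-free update of the decision variables. -/
noncomputable def meanX (W : Matrix (Fin n) (Fin n) ℝ) (f : Fin n → Vec r → ℝ) (α γ : ℝ)
    (s x : Fin n → Vec r) : Fin n → Vec r := mix W x - α • (meanS W f γ s x - s)

lemma nextS_eq_meanS_add (W : Matrix (Fin n) (Fin n) ℝ) (f : Fin n → Vec r → ℝ) (γ β : ℝ)
    (η s x : Fin n → Vec r) :
    nextS W f γ β η s x = meanS W f γ s x + β • offMix W η := nextS_eq W f γ β η s x

/-- The tracking noise `η` reaches `x` in the same iteration, through `s_{k+1} - s_k`; this produces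
the summand with `α`. -/
lemma nextX_eq_meanX_add (W : Matrix (Fin n) (Fin n) ℝ) (f : Fin n → Vec r → ℝ) (α γ β : ℝ)
    (η ξ s x : Fin n → Vec r) :
    nextX W α β ξ s (nextS W f γ β η s x) x
      = meanX W f α γ s x + β • (offMix W ξ - α • offMix W η) := by
  rw [nextX_eq, nextS_eq_meanS_add, meanX]
  simp only [smul_sub, smul_add, smul_comm β α]
  abel

section

variable {W : Matrix (Fin n) (Fin n) ℝ} {f : Fin n → Vec r → ℝ}

lemma avg_meanX (hW : IsCoupling W) (α γ : ℝ) (s x : Fin n → Vec r) :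
    avg (meanX W f α γ s x) = avg x - (α * γ) • avg (stackGrad f x) := by
  simp only [meanX, meanS, avg_sub, avg_mix hW, avg_smul, avg_add, mul_smul, add_sub_cancel_left]

/-- For gradients frozen at `g`, the deviation `t` is the fixed point of tracking. Measured from
`t`, only the change of the gradients away from `g` drives the error. -/
lemma dev_meanS_sub (hW : IsCoupling W) {γ : ℝ} {t g : Fin n → Vec r}
    (ht : t - mix W t = γ • dev g) (s x : Fin n → Vec r) :
    dev (meanS W f γ s x) - t = mix W (dev s - t) + γ • dev (stackGrad f x - g) := by
  have : t = mix W t + γ • dev g := by rw [← ht]; abel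
  simp only [meanS, dev_add, dev_mix hW, dev_smul, mix_sub, dev_sub, smul_sub]
  conv_lhs => rw [this]
  abel

lemma dev_meanX (hW : IsCoupling W) {α γ : ℝ} {t g : Fin n → Vec r}
    (ht : t - mix W t = γ • dev g) (s x : Fin n → Vec r) :
    dev (meanX W f α γ s x) = mix W (dev x)
      + α • ((dev s - t) - mix W (dev s - t) - γ • dev (stackGrad f x - g)) := by
  have h := dev_meanS_sub (f := f) hW ht s x
  have h2 : dev (meanS W f γ s x) - dev s
      = (mix W (dev s - t) + γ • dev (stackGrad f x - g)) - (dev s - t) := by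
    rw [← h]; abel
  simp only [meanX, dev_sub, dev_mix hW, dev_smul] at h2 ⊢
  rw [h2]
  simp only [smul_sub, smul_add]
  abel

lemma sqn_dev_meanS_sub_le (hW : IsCoupling W) {γ : ℝ} {t g : Fin n → Vec r} (ht0 : avg t = 0)
    (ht : t - mix W t = γ • dev g) (s x : Fin n → Vec r) :
    sqn (dev (meanS W f γ s x) - t) ≤ rhoW W * sqn (dev s - t)
      + γ ^ 2 * sqn (dev (stackGrad f x - g)) / (1 - rhoW W) := by
  have := neZero_of_isCoupling hW
  rw [dev_meanS_sub hW ht, ← sqn_smul]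
  exact sqn_add_le_of_contraction (rhoW_nonneg W) (rhoW_lt_one hW)
    (sqn_mix_le hW (by rw [avg_sub, avg_dev, ht0, sub_zero]))

lemma sqn_dev_meanX_le (hW : IsCoupling W) {α γ : ℝ} {t g : Fin n → Vec r} (ht0 : avg t = 0)
    (ht : t - mix W t = γ • dev g) (s x : Fin n → Vec r) :
    sqn (dev (meanX W f α γ s x)) ≤ rhoW W * sqn (dev x)
      + α ^ 2 * (2 * (1 + rhoW W) * sqn (dev s - t)
        + 2 / (1 - rhoW W) * (γ ^ 2 * sqn (dev (stackGrad f x - g)))) / (1 - rhoW W) := by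
  have := neZero_of_isCoupling hW
  have h1 : 0 < 1 - rhoW W := by linarith [rhoW_lt_one hW]
  rw [dev_meanX hW ht]
  refine (sqn_add_le_of_contraction (rhoW_nonneg W) (rhoW_lt_one hW)
    (sqn_mix_le hW (avg_dev x))).trans ?_
  rw [sqn_smul, ← sqn_smul γ]
  have := sqn_sub_mix_le (w := γ • dev (stackGrad f x - g)) hW
    (z := dev s - t) (by rw [avg_sub, avg_dev, ht0, sub_zero])
  gcongr

/-- `I - W` is invertible on the stacked vectors with zero average. -/
lemma exists_sub_mix_eq (hW : IsCoupling W) {g : Fin n → Vec r} (hg : avg g = 0) :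
    ∃ t : Fin n → Vec r, avg t = 0 ∧ t - mix W t = g := by
  have := neZero_of_isCoupling hW
  -- Adding the average repairs the kernel of `I - W`: `T` preserves averages, so its kernel
  -- consists of zero-average fixed points of `W`, which vanish since `ρ_w < 1`. In finite dimension
  -- injectivity gives surjectivity.
  let T : (Fin n → Vec r) →ₗ[ℝ] (Fin n → Vec r) :=
    { toFun := fun z => z - mix W z + fun _ => avg z
      map_add' := fun z w => by
        rw [mix_add, avg_add]; ext1 i; simp only [Pi.add_apply, Pi.sub_apply]; abel
      map_smul' := fun c z => by
        rw [mix_smul, avg_smul]; ext1 i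
        simp [smul_add, smul_sub] }
  have hT : ∀ z, avg (T z) = avg z := fun z => by
    change avg (z - mix W z + fun _ => avg z) = _
    rw [avg_add, avg_sub, avg_mix hW, avg_const]; abel
  have hinj : Function.Injective T := by
    rw [← LinearMap.ker_eq_bot, LinearMap.ker_eq_bot']
    intro z hz
    have h0 : avg z = 0 := by rw [← hT, hz]; simp [avg]
    have h1 : z = mix W z := by
      have : z - mix W z + (fun _ => avg z) = 0 := hz
      rw [h0] at this
      have h2 : z - mix W z = 0 := by simpa [Pi.zero_def] using this
      exact sub_eq_zero.1 h2
    have h2 := sqn_mix_le hW h0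
    rw [← h1] at h2
    have h3 : sqn z = 0 := by
      have h4 : rhoW W ^ 2 < 1 := pow_lt_one₀ (rhoW_nonneg W) (rhoW_lt_one hW) two_ne_zero
      nlinarith [sqn_nonneg z]
    ext1 i
    have := (Finset.sum_eq_zero_iff_of_nonneg (fun i _ => by positivity)).1 h3 i
      (Finset.mem_univ i)
    simpa using this
  obtain ⟨t, ht⟩ := (LinearMap.injective_iff_surjective.1 hinj) g
  have h0 : avg t = 0 := by rw [← hT, ht, hg]
  refine ⟨t, h0, ?_⟩
  have : t - mix W t + (fun _ => avg t) = g := ht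
  rw [h0, show (fun _ : Fin n => (0 : Vec r)) = 0 from rfl, add_zero] at this
  exact this

lemma avg_stackGrad_of_isMinimizer {μ L : ℝ} [NeZero n] (hf : IsObjective f μ L) {xstar : Vec r}
    (hx : IsMinimizer f xstar) : avg (stackGrad f fun _ => xstar) = 0 := by
  have h1 : HasFDerivAt (fun z => (1 / (n : ℝ)) * ∑ i, f i z)
      ((1 / (n : ℝ)) • ∑ i, InnerProductSpace.toDual ℝ (Vec r) (gradient (f i) xstar)) xstar := by
    refine HasFDerivAt.const_mul ?_ _
    exact HasFDerivAt.fun_sum fun i _ => ((hf.differentiable i) xstar).hasGradientAt.hasFDerivAt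
  have h2 : IsLocalMin (fun z => (1 / (n : ℝ)) * ∑ i, f i z) xstar :=
    Filter.Eventually.of_forall hx
  have h3 := h2.hasFDerivAt_eq_zero h1
  rw [← map_sum, ← map_smul] at h3
  exact (InnerProductSpace.toDual ℝ (Vec r)).map_eq_zero_iff.1 h3

lemma sqn_sub_const [NeZero n] (x : Fin n → Vec r) (v : Vec r) :
    sqn (x - fun _ => v) = n * ‖avg x - v‖ ^ 2 + sqn (dev x) := by
  rw [sqn_eq, avg_sub, dev_sub, avg_const, dev_const, sub_zero]

lemma sqn_stackGrad_sub_le {μ L : ℝ} (hf : IsObjective f μ L) (x y : Fin n → Vec r) :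
    sqn (stackGrad f x - stackGrad f y) ≤ L ^ 2 * sqn (x - y) := by
  simp only [sqn, Finset.mul_sum]
  refine Finset.sum_le_sum fun i _ => ?_
  rw [← mul_pow]
  exact pow_le_pow_left₀ (norm_nonneg _) (hf.lipschitz i _ _) 2

/-- Comparing the two hypotheses needs a nonzero vector, so `r = 0` has to be treated apart. -/
lemma IsObjective.le [Nontrivial (Vec r)] [NeZero n] {μ L : ℝ} (hf : IsObjective f μ L) :
    μ ≤ L := by
  obtain ⟨v, hv⟩ := exists_ne (0 : Vec r)
  have h1 := hf.strongly_convex 0 v 0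
  have h2 := real_inner_le_norm (gradient (f 0) v - gradient (f 0) 0) (v - 0)
  have h3 := mul_le_mul_of_nonneg_right (hf.lipschitz 0 v 0) (norm_nonneg (v - 0))
  have h4 : 0 < ‖v - 0‖ := by simpa using hv
  have h5 : μ * ‖v - 0‖ ^ 2 ≤ L * ‖v - 0‖ ^ 2 := by nlinarith
  exact le_of_mul_le_mul_right h5 (by positivity)

lemma sum_sector {μ L : ℝ} (hμ : 0 ≤ μ) (hμL : μ ≤ L) (hf : IsObjective f μ L)
    (x y : Fin n → Vec r) :
    μ * L * sqn (x - y) + sqn (stackGrad f x - stackGrad f y)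
      ≤ (μ + L) * ∑ i, inner ℝ ((stackGrad f x - stackGrad f y) i) ((x - y) i) := by
  simp only [sqn, Finset.mul_sum, ← Finset.sum_add_distrib]
  exact Finset.sum_le_sum fun i _ => sector_inequality hμL
    (fun z => (hf.differentiable i z).hasGradientAt) (hf.strongly_convex i) (hf.lipschitz i) hμ _ _

lemma sum_strongly_convex {μ L : ℝ} (hf : IsObjective f μ L) (x y : Fin n → Vec r) :
    μ * sqn (x - y) ≤ ∑ i, inner ℝ ((stackGrad f x - stackGrad f y) i) ((x - y) i) := by
  simp only [sqn, Finset.mul_sum]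
  exact Finset.sum_le_sum fun i _ => hf.strongly_convex i _ _

/-- Cocoercivity follows from the sector inequality. -/
lemma cocoercive_of_sector {μ L P H T : ℝ} (hμ : 0 < μ) (hμL : μ ≤ L)
    (hH : H ≤ L ^ 2 * P) (h1 : μ * L * P + H ≤ (μ + L) * T) : H ≤ L * T := by
  have hL : 0 < L := by linarith
  have h2 : H * (μ + L) ≤ L * T * (μ + L) := by nlinarith
  exact le_of_mul_le_mul_right h2 (by linarith)

lemma dist_avg_meanX (hW : IsCoupling W) {α γ : ℝ} {xstar : Vec r}
    (h0 : avg (stackGrad f fun _ => xstar) = 0) (s x : Fin n → Vec r) :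
    n * ‖avg (meanX W f α γ s x) - xstar‖ ^ 2 = n * ‖avg x - xstar‖ ^ 2
      - 2 * (α * γ) * (n * inner ℝ (avg (stackGrad f x - stackGrad f fun _ => xstar))
        (avg x - xstar))
      + (α * γ) ^ 2 * (n * ‖avg (stackGrad f x - stackGrad f fun _ => xstar)‖ ^ 2) := by
  have h1 : avg (stackGrad f x) = avg (stackGrad f x - stackGrad f fun _ => xstar) := by
    rw [avg_sub, h0, sub_zero]
  have h2 : avg x - (α * γ) • avg (stackGrad f x) - xstar = (avg x - xstar)
    - (α * γ) • avg (stackGrad f x - stackGrad f fun _ => xstar) := by rw [h1]; abel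
  rw [avg_meanX hW, h2, norm_sub_sq_real, inner_smul_right, norm_smul, mul_pow,
    Real.norm_eq_abs, sq_abs, real_inner_comm]
  ring

end

/-! ### Constant stepsize: contraction of the Lyapunov function. -/

/-- A weighted sum of the squared optimality, consensus and tracking errors. -/
noncomputable def lyap (xstar : Vec r) (t : Fin n → Vec r) (A B : ℝ) (s x : Fin n → Vec r) : ℝ :=
  n * ‖avg x - xstar‖ ^ 2 + A * consErr x + B * sqn (dev s - t)

/-- In fact `d_I² = n - 1`. This allows `d_I` to be dropped from `c₄₂`. -/
lemma dI_sq_ge (hn : 2 ≤ n) : 1 ≤ dI n ^ 2 := by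
  have hn0 : (n : ℝ) ≠ 0 := by positivity
  have hn2 : (2 : ℝ) ≤ n := by exact_mod_cast hn
  have hsq : dI n ^ 2 = ∑ i : Fin n, ∑ j : Fin n,
      ((1 : Matrix (Fin n) (Fin n) ℝ) - avgMat n) i j ^ 2 :=
    Real.sq_sqrt (Finset.sum_nonneg fun _ _ => Finset.sum_nonneg fun _ _ => sq_nonneg _)
  rw [hsq]
  have h : ∀ i : Fin n, ∑ j : Fin n, ((1 : Matrix (Fin n) (Fin n) ℝ) - avgMat n) i j ^ 2
      = 1 - 1 / n := fun i => by
    have h1 : ∀ j : Fin n, ((1 : Matrix (Fin n) (Fin n) ℝ) - avgMat n) i j ^ 2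
        = (if i = j then 1 - 2 * (1 / (n : ℝ)) else 0) + (1 / (n : ℝ)) ^ 2 := fun j => by
      by_cases hij : i = j
      · subst hij
        simp [avgMat]; ring
      · simp [avgMat, hij]
    rw [Finset.sum_congr rfl fun j _ => h1 j, Finset.sum_add_distrib]
    simp only [Finset.sum_ite_eq, Finset.mem_univ, if_true, Finset.sum_const, Finset.card_univ,
      Fintype.card_fin, nsmul_eq_mul]
    field_simp
    ring
  rw [Finset.sum_congr rfl fun i _ => h i]
  simp only [Finset.sum_const, Finset.card_univ, Fintype.card_fin, nsmul_eq_mul]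
  field_simp
  linarith

/-- The third bound yields `a² c₄₂ ≤ 1`, because the radicand is at least `c₄₂`. With `c₄₂ ≥ 64 (1 +
ρ²) L² / (1 - ρ²)⁴` and `(1 + ρ)⁴ ≤ 8 (1 + ρ²)` the claim follows. -/
lemma StepBound.sq_le {W : Matrix (Fin n) (Fin n) ℝ} (hW : IsCoupling W) (hn : 2 ≤ n)
    {μ L a : ℝ} (hμ : 0 < μ) (hL : 0 < L) (ha : 0 < a) (h : StepBound W μ L a) :
    8 * (a * L) ^ 2 ≤ (1 - rhoW W) ^ 4 := by
  have hd := dI_sq_ge hn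
  have h0 := rhoW_nonneg W
  have h1 : 0 < 1 - rhoW W := by linarith [rhoW_lt_one hW]
  obtain ⟨-, -, h3⟩ := h
  set ρ := rhoW W with hρ
  have h1' : 0 < 1 - ρ ^ 2 := by nlinarith
  have hc42 : 64 * (1 + ρ ^ 2) * L ^ 2 / (1 - ρ ^ 2) ^ 4 ≤ c42 W μ L := by
    rw [c42, ← hρ, div_le_div_iff₀ (by positivity) (by positivity)]
    have e1 : 64 * (1 + ρ ^ 2) * L ^ 2 * ((1 - ρ ^ 2) ^ 4 * (μ + L))
        = (64 * (1 + ρ ^ 2) * L ^ 2 * (1 - ρ ^ 2) ^ 4) * ((μ + L) * 1) := by ring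
    have e2 : 64 * (1 + ρ ^ 2) * (μ + L + 2 * L ^ 2) * L ^ 2 * dI n ^ 2 * (1 - ρ ^ 2) ^ 4
        = (64 * (1 + ρ ^ 2) * L ^ 2 * (1 - ρ ^ 2) ^ 4) * ((μ + L + 2 * L ^ 2) * dI n ^ 2) := by
      ring
    rw [e1, e2]
    have : 0 ≤ 2 * L ^ 2 := by positivity
    refine mul_le_mul_of_nonneg_left ?_ (by positivity)
    exact mul_le_mul (by linarith) hd zero_le_one (by positivity)
  have hc0 : 0 ≤ c42 W μ L := le_trans (by positivity) hc42
  have hc41 : 0 ≤ c41 W μ L := by rw [c41]; positivity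
  have h4 : c42 W μ L ≤ (c42 W μ L + Real.sqrt (c42 W μ L ^ 2 + 4 * c41 W μ L)) / 2 := by
    have : c42 W μ L ≤ Real.sqrt (c42 W μ L ^ 2 + 4 * c41 W μ L) :=
      Real.le_sqrt_of_sq_le (by linarith)
    linarith
  have h5 : a ^ 2 * c42 W μ L ≤ 1 := by
    have h6 := pow_le_one₀ (n := 2) (by positivity) h3.le
    rw [mul_pow, Real.sq_sqrt (hc0.trans h4)] at h6
    exact le_trans (by gcongr) h6
  have h7 : a ^ 2 * (64 * (1 + ρ ^ 2) * L ^ 2 / (1 - ρ ^ 2) ^ 4) ≤ 1 :=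
    le_trans (by gcongr) h5
  rw [← mul_div_assoc, div_le_one (by positivity)] at h7
  have e3 : (1 - ρ ^ 2) ^ 4 = (1 - ρ) ^ 4 * ((1 + ρ) ^ 2 * (1 + ρ) ^ 2) := by ring
  have h8 : (1 + ρ) ^ 2 * (1 + ρ) ^ 2 ≤ (2 * (1 + ρ ^ 2)) * 4 := by
    have i1 : (1 + ρ) ^ 2 ≤ 2 * (1 + ρ ^ 2) := by nlinarith [sq_nonneg (1 - ρ)]
    have i2 : (1 + ρ) ^ 2 ≤ 4 := by nlinarith
    gcongr
  have h9 : (8 * (1 + ρ ^ 2)) * (8 * (a * L) ^ 2) ≤ (8 * (1 + ρ ^ 2)) * (1 - ρ) ^ 4 := by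
    calc _ = a ^ 2 * (64 * (1 + ρ ^ 2) * L ^ 2) := by ring
      _ ≤ _ := h7
      _ = _ := e3
      _ ≤ (1 - ρ) ^ 4 * ((2 * (1 + ρ ^ 2)) * 4) := by gcongr
      _ = _ := by ring
  exact le_of_mul_le_mul_left h9 (by positivity)

/-- Of the descent `2aT` the part `9/5 aT` pays for all gradient terms; `1/5 aT` is kept for strong
convexity. The constant `49/10` is `5/2 + 12/5`, from the cross term and from tracking in
`lyap_scalar`; `49/10 · 5/14 = 7/4 ≤ 9/5`. -/
lemma gradient_absorption {a L δ Hb Hp T : ℝ} (ha : 0 < a) (hL : 0 < L) (hδ : 0 < δ) (hδ1 : δ ≤ 1)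
    (haL : 14 / 5 * (a * L) ≤ δ ^ 2) (hHb : 0 ≤ Hb) (hHp : 0 ≤ Hp) (hT : Hb / L + Hp / L ≤ T) :
    a ^ 2 * Hb + 49 / 10 * (a ^ 2 * Hp / δ ^ 2) ≤ 9 / 5 * a * T := by
  have i1 : a * L / δ ^ 2 ≤ 5 / 14 := by
    rw [div_le_iff₀ (by positivity)]; linarith
  have i2 : a * L ≤ 9 / 5 := by
    have : δ ^ 2 ≤ 1 := pow_le_one₀ hδ.le hδ1
    linarith
  have j1 : a ^ 2 * Hb ≤ 9 / 5 * a * (Hb / L) := by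
    have e : a ^ 2 * Hb = (a * L) * a * (Hb / L) := by field_simp
    rw [e]
    gcongr
  have j2 : 49 / 10 * (a ^ 2 * Hp / δ ^ 2) ≤ 9 / 5 * a * (Hp / L) := by
    have e : 49 / 10 * (a ^ 2 * Hp / δ ^ 2) = (49 / 10 * (a * L / δ ^ 2)) * a * (Hp / L) := by
      field_simp
    rw [e]
    have : 49 / 10 * (a * L / δ ^ 2) ≤ 9 / 5 := by linarith
    gcongr
  have j4 := mul_le_mul_of_nonneg_left hT (show 0 ≤ 9 / 5 * a by positivity)
  linarith

/-- The scalar estimate behind the contraction of the Lyapunov function. -/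
lemma lyap_scalar {ρ a L μ α E X S Hb Hp c d E' X' S' γ : ℝ} (h0 : 0 ≤ ρ) (h1 : ρ < 1)
    (ha : a = α * γ) (hapos : 0 < a) (hL : 0 < L) (hα : 0 < α)
    (hstep : 8 * (a * L) ^ 2 ≤ (1 - ρ) ^ 4) (hHb : 0 ≤ Hb) (hHp : 0 ≤ Hp)
    (hS : 0 ≤ S) (hX : 0 ≤ X)
    (hμ : 0 < μ) (hT1 : Hb + Hp ≤ L * (c + d)) (hT2 : μ * (E + X) ≤ c + d)
    (hE' : E' = E - 2 * a * c + a ^ 2 * Hb)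
    (hS' : S' ≤ ρ * S + γ ^ 2 * Hp / (1 - ρ))
    (hX' : X' ≤ ρ * X + α ^ 2 * (2 * (1 + ρ) * S + 2 / (1 - ρ) * (γ ^ 2 * Hp)) / (1 - ρ))
    (hd : ∀ k, 0 < k → 2 * d ≤ k * X + 1 / k * Hp) :
    E' + (1 - ρ) / 2 * X' + α ^ 2 * (6 / 5 * (1 + ρ) / (1 - ρ)) * S'
      ≤ (1 - a * μ / 5) * E + (1 - (1 - ρ) / 6) * ((1 - ρ) / 2 * X
        + α ^ 2 * (6 / 5 * (1 + ρ) / (1 - ρ)) * S) := by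
  obtain ⟨δ, rfl⟩ : ∃ δ, ρ = 1 - δ := ⟨1 - ρ, by ring⟩
  have hδ : 0 < δ := by linarith
  have hδ1 : δ ≤ 1 := by linarith
  simp only [sub_sub_cancel] at *
  have hTT : Hb / L + Hp / L ≤ c + d := by
    rw [← add_div, div_le_iff₀ hL]; linarith
  -- Here `(14/5)² = 7.84 ≤ 8`.
  have haL : 14 / 5 * (a * L) ≤ δ ^ 2 := by
    have : (14 / 5 * (a * L)) ^ 2 ≤ (δ ^ 2) ^ 2 := by nlinarith [sq_nonneg (a * L)]
    exact (pow_le_pow_iff_left₀ (by positivity) (by positivity) two_ne_zero).1 this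
  -- The cross term may cost `2/5 δ² X`: consensus supplies `δ/2 · δ X`, and the remaining `δ²/10 X`
  -- exceeds the `δ²/12 X` that the rate `δ/6` needs.
  have hd' : 2 * a * d ≤ 2 / 5 * δ ^ 2 * X + 5 / 2 * (a ^ 2 * Hp / δ ^ 2) := by
    have h := mul_le_mul_of_nonneg_left (hd (2 / 5 * δ ^ 2 / a) (by positivity)) hapos.le
    have e : a * (2 / 5 * δ ^ 2 / a * X + 1 / (2 / 5 * δ ^ 2 / a) * Hp)
        = 2 / 5 * δ ^ 2 * X + 5 / 2 * (a ^ 2 * Hp / δ ^ 2) := by field_simp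
    rw [e] at h; linarith
  have hXA : δ / 2 * X' ≤ δ / 2 * ((1 - δ) * X) + α ^ 2 * (2 - δ) * S + a ^ 2 * Hp / δ := by
    have h := mul_le_mul_of_nonneg_left hX' (show 0 ≤ δ / 2 by positivity)
    have e : δ / 2 * ((1 - δ) * X + α ^ 2 * (2 * (1 + (1 - δ)) * S + 2 / δ * (γ ^ 2 * Hp)) / δ)
        = δ / 2 * ((1 - δ) * X) + α ^ 2 * (2 - δ) * S + (α * γ) ^ 2 * Hp / δ := by
      field_simp; ring
    rw [e, ← ha] at h; exact h
  have hSB : α ^ 2 * (6 / 5 * (1 + (1 - δ)) / δ) * S'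
      ≤ α ^ 2 * (6 / 5 * (1 + (1 - δ)) / δ) * ((1 - δ) * S)
        + 6 / 5 * (2 - δ) * (a ^ 2 * Hp / δ ^ 2) := by
    have h := mul_le_mul_of_nonneg_left hS'
      (show 0 ≤ α ^ 2 * (6 / 5 * (1 + (1 - δ)) / δ) by
        have : 0 < 1 + (1 - δ) := by linarith
        positivity)
    have e : α ^ 2 * (6 / 5 * (1 + (1 - δ)) / δ) * ((1 - δ) * S + γ ^ 2 * Hp / δ)
        = α ^ 2 * (6 / 5 * (1 + (1 - δ)) / δ) * ((1 - δ) * S)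
        + 6 / 5 * (2 - δ) * ((α * γ) ^ 2 * Hp / δ ^ 2) := by
      field_simp; ring
    rw [e, ← ha] at h; exact h
  -- The factor `6/5` in the tracking weight is chosen so that feeding `S` into consensus uses `5/6`
  -- of the tracking contraction `δ`, leaving `δ/6`.
  have hS6 : α ^ 2 * (2 - δ) * S = 5 / 6 * δ * (α ^ 2 * (6 / 5 * (1 + (1 - δ)) / δ) * S) := by
    field_simp; ring
  have hH := gradient_absorption hapos hL hδ hδ1 haL hHb hHp hTT
  have hHδ : a ^ 2 * Hp / δ ≤ δ * (a ^ 2 * Hp / δ ^ 2) := by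
    apply le_of_eq; field_simp
  have hHp0 : 0 ≤ a ^ 2 * Hp / δ ^ 2 := by positivity
  have hSB0 : 0 ≤ α ^ 2 * (6 / 5 * (1 + (1 - δ)) / δ) * S := by
    have : 0 < 1 + (1 - δ) := by linarith
    positivity
  have hT3 := mul_le_mul_of_nonneg_left hT2 (show 0 ≤ a / 5 by positivity)
  have hXd : 0 ≤ δ ^ 2 * X := by positivity
  have haX : 0 ≤ a * μ * X := by positivity
  have hHδ2 : 0 ≤ δ * (a ^ 2 * Hp / δ ^ 2) := by positivity
  rw [hE']
  set K := a ^ 2 * Hp / δ ^ 2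
  set SB := α ^ 2 * (6 / 5 * (1 + (1 - δ)) / δ) * S
  have hSB' : α ^ 2 * (6 / 5 * (1 + (1 - δ)) / δ) * ((1 - δ) * S) = (1 - δ) * SB := by
    simp only [SB]; ring
  rw [hSB'] at hSB
  rw [hS6] at hXA
  clear_value K SB
  generalize α ^ 2 * (6 / 5 * (1 + (1 - δ)) / δ) * S' = SB' at *
  linarith

/-- Mean contraction for a constant stepsize. -/
lemma lyap_contraction {W : Matrix (Fin n) (Fin n) ℝ} (hW : IsCoupling W)
    {f : Fin n → Vec r → ℝ} {μ L α γ : ℝ} (hμ : 0 < μ) (hα : 0 < α) (hγ : 0 < γ)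
    (hf : IsObjective f μ L) {xstar : Vec r} (hx : IsMinimizer f xstar)
    (hb : StepBound W μ L (α * γ)) {t : Fin n → Vec r} (ht0 : avg t = 0)
    (ht : t - mix W t = γ • dev (stackGrad f fun _ => xstar)) :
    ∃ A B c : ℝ, 0 < A ∧ 0 < B ∧ 0 < c ∧ c ≤ 1 ∧ ∀ s x : Fin n → Vec r,
      lyap xstar t A B (meanS W f γ s x) (meanX W f α γ s x) ≤ (1 - c) * lyap xstar t A B s x := by
  have hn := neZero_of_isCoupling hW
  -- For `r = 0` every error vanishes.
  rcases subsingleton_or_nontrivial (Vec r) with hr | hr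
  · refine ⟨1, 1, 1, one_pos, one_pos, one_pos, le_rfl, fun s x => ?_⟩
    have h0 : ∀ v : Vec r, v = 0 := fun v => Subsingleton.elim _ _
    have h1 : ∀ z : Fin n → Vec r, sqn z = 0 := fun z => by simp [sqn, h0]
    have h2 : ∀ s x : Fin n → Vec r, lyap xstar t 1 1 s x = 0 := fun s x => by
      simp [lyap, consErr_eq, h1, h0 (avg x - xstar)]
    simp [h2]
  have hμL := hf.le
  have hL : 0 < L := hμ.trans_le hμL
  have ha : 0 < α * γ := mul_pos hα hγ
  have hg := avg_stackGrad_of_isMinimizer hf hx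
  have key : ∀ x : Fin n → Vec r, ∑ i, inner ℝ ((stackGrad f x - stackGrad f fun _ => xstar) i)
      ((x - fun _ => xstar : Fin n → Vec r) i)
      = n * inner ℝ (avg (stackGrad f x - stackGrad f fun _ => xstar)) (avg x - xstar)
        + ∑ i, inner ℝ (dev (stackGrad f x - stackGrad f fun _ => xstar) i) (dev x i) := by
    intro x
    rw [sum_inner_eq, avg_sub x, dev_sub x, avg_const, dev_const, sub_zero]
  have hsec := fun x => sum_sector hμ.le hμL hf x fun _ => xstar
  simp only [key, sqn_sub_const] at hsec
  -- For one agent `d_I = 0` and the third bound is void. All deviations vanish, and `a ≤ 2 / (μ +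
  -- L)` gives the classical gradient descent rate `1 - 2aμL / (μ + L)`.
  rcases (show n = 1 ∨ 2 ≤ n by have := hn.out; omega) with h1 | h2
  · refine ⟨1, 1, min 1 (2 * (α * γ) * μ * L / (μ + L)), one_pos, one_pos, by positivity,
      min_le_left _ _, fun s x => ?_⟩
    have hdev : ∀ z : Fin n → Vec r, avg z = 0 → z = 0 := by
      subst h1
      intro z hz
      ext1 i
      rw [Subsingleton.elim i 0]
      simpa [avg] using hz
    have hd0 : ∀ z : Fin n → Vec r, dev z = 0 := fun z => hdev _ (avg_dev z)
    have hs0 : sqn (0 : Fin n → Vec r) = 0 := by simp [sqn]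
    have h3 := hsec x
    rw [sqn_eq (stackGrad f x - stackGrad f fun _ => xstar)] at h3
    simp only [hd0, hs0, add_zero, Pi.zero_apply, inner_zero_left, Finset.sum_const_zero] at h3
    simp only [lyap, consErr_eq, hd0, hdev t ht0, sub_zero, hs0, mul_zero, add_zero]
    rw [dist_avg_meanX hW hg]
    set Hb := (n : ℝ) * ‖avg (stackGrad f x - stackGrad f fun _ => xstar)‖ ^ 2 with hHb
    set E := (n : ℝ) * ‖avg x - xstar‖ ^ 2 with hE
    set c := (n : ℝ) * inner ℝ (avg (stackGrad f x - stackGrad f fun _ => xstar)) (avg x - xstar)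
    have hHb0 : 0 ≤ Hb := by positivity
    have hE0 : 0 ≤ E := by positivity
    have h4 : α * γ * (μ + L) ≤ 2 := by
      have := hb.1.le
      rwa [le_div_iff₀ (by positivity)] at this
    have h5 : (1 - 2 * (α * γ) * μ * L / (μ + L)) * E
        ≤ (1 - min 1 (2 * (α * γ) * μ * L / (μ + L))) * E := by
      gcongr; exact min_le_right _ _
    refine le_trans ?_ h5
    have h6 : (μ * L * E + Hb) / (μ + L) ≤ c := by
      rw [div_le_iff₀ (by positivity)]; linarith
    have h7 : (α * γ) ^ 2 * Hb ≤ 2 * (α * γ) * (Hb / (μ + L)) := by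
      have : (α * γ) ^ 2 * Hb = (α * γ) * (α * γ * (μ + L)) * (Hb / (μ + L)) := by field_simp
      rw [this]
      have h8 : (α * γ) * (α * γ * (μ + L)) ≤ (α * γ) * 2 := by gcongr
      have h9 : 0 ≤ Hb / (μ + L) := by positivity
      nlinarith
    have h10 := mul_le_mul_of_nonneg_left h6 (show 0 ≤ 2 * (α * γ) by positivity)
    have e : 2 * (α * γ) * ((μ * L * E + Hb) / (μ + L))
        = 2 * (α * γ) * μ * L / (μ + L) * E + 2 * (α * γ) * (Hb / (μ + L)) := by
      field_simp
    rw [e] at h10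
    linarith
  · have hρ0 := rhoW_nonneg W
    have hρ1 := rhoW_lt_one hW
    have hδ : 0 < 1 - rhoW W := by linarith
    refine ⟨(1 - rhoW W) / 2, α ^ 2 * (6 / 5 * (1 + rhoW W) / (1 - rhoW W)),
      min (α * γ * μ / 5) ((1 - rhoW W) / 6), by positivity, by positivity, by positivity,
      (min_le_right _ _).trans (by linarith), fun s x => ?_⟩
    have hT1 := cocoercive_of_sector hμ hμL ?_ (hsec x)
    swap
    · rw [← sqn_sub_const]; exact sqn_stackGrad_sub_le hf _ _
    have hT2 := sum_strongly_convex hf x fun _ => xstar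
    rw [key, sqn_sub_const] at hT2
    rw [sqn_eq] at hT1
    have hfin := lyap_scalar (γ := γ) hρ0 hρ1 rfl ha hL hα (hb.sq_le hW h2 hμ hL ha)
      (by positivity) (sqn_nonneg _) (sqn_nonneg (dev s - t)) (sqn_nonneg _) hμ hT1 hT2
      (dist_avg_meanX hW hg s x) (sqn_dev_meanS_sub_le (f := f) hW ht0 ht s x)
      (sqn_dev_meanX_le (f := f) (α := α) hW ht0 ht s x)
      (fun k hk => by
        have := two_sum_inner_le (dev x) (dev (stackGrad f x - stackGrad f fun _ => xstar)) hk
        simpa only [real_inner_comm] using this)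
    simp only [lyap, consErr_eq]
    refine hfin.trans ?_
    set c := min (α * γ * μ / 5) ((1 - rhoW W) / 6)
    have hX0 : 0 ≤ (1 - rhoW W) / 2 * sqn (dev x)
        + α ^ 2 * (6 / 5 * (1 + rhoW W) / (1 - rhoW W)) * sqn (dev s - t) := by
      have := sqn_nonneg (dev x)
      have := sqn_nonneg (dev s - t)
      positivity
    have hE0 : 0 ≤ (n : ℝ) * ‖avg x - xstar‖ ^ 2 := by positivity
    have c1 : c ≤ α * γ * μ / 5 := min_le_left _ _
    have c2 : c ≤ (1 - rhoW W) / 6 := min_le_right _ _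
    have k1 := mul_le_mul_of_nonneg_right c1 hE0
    have k2 := mul_le_mul_of_nonneg_right c2 hX0
    linarith

/-! ### Decaying stepsize: one-step estimates. -/

section

variable {W : Matrix (Fin n) (Fin n) ℝ} {f : Fin n → Vec r → ℝ}

/-- The average performs an inexact gradient step, contracting at the rate `1 - a μ`. -/
lemma dist_avg_meanX_le (hW : IsCoupling W) {μ L α γ : ℝ} (hμ : 0 < μ) (hf : IsObjective f μ L)
    {xstar : Vec r} (hx : IsMinimizer f xstar) (ha : 0 < α * γ)
    (h1 : α * γ * L ^ 2 ≤ μ / 4) (h2 : α * γ * μ ≤ 1) (s x : Fin n → Vec r) :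
    n * ‖avg (meanX W f α γ s x) - xstar‖ ^ 2
      ≤ (1 - α * γ * μ) * (n * ‖avg x - xstar‖ ^ 2)
        + 3 * L ^ 2 / μ * (α * γ) * sqn (dev x) := by
  have := neZero_of_isCoupling hW
  set a := α * γ with haa
  set z : Fin n → Vec r := fun _ => avg x with hz
  set m := avg (stackGrad f z - stackGrad f fun _ => xstar) with hm
  have h0 := avg_stackGrad_of_isMinimizer hf hx
  set e := avg x - xstar with he
  -- An exact gradient step at the average, plus the gradient error caused by disagreement.
  have hsplit : avg (meanX W f α γ s x) - xstar
      = (e - a • m) + a • avg (stackGrad f z - stackGrad f x) := by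
    rw [avg_meanX hW, hm, avg_sub, h0, sub_zero, avg_sub, smul_sub, he, haa]; abel
  have hzx : sqn (z - fun _ => xstar) = n * ‖e‖ ^ 2 := by
    rw [sqn_sub_const, hz, avg_const, dev_const]; simp [sqn, he]
  have hm1 : μ * ‖e‖ ^ 2 * n ≤ n * inner ℝ m e := by
    have h := sum_strongly_convex hf z fun _ => xstar
    have h3 : ∑ i, inner ℝ ((stackGrad f z - stackGrad f fun _ => xstar) i)
        ((z - fun _ => xstar : Fin n → Vec r) i)
        = n * inner ℝ m e := by
      rw [sum_inner_eq, avg_sub z, dev_sub z, hz, avg_const, dev_const, avg_const, dev_const]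
      simp [hm, he, hz]
    rw [hzx, h3] at h
    linarith
  have hm2 : n * ‖m‖ ^ 2 ≤ L ^ 2 * (n * ‖e‖ ^ 2) := by
    rw [← hzx]
    exact (norm_avg_sq_le _).trans (sqn_stackGrad_sub_le hf _ _)
  have hd : n * ‖avg (stackGrad f z - stackGrad f x)‖ ^ 2 ≤ L ^ 2 * sqn (dev x) := by
    refine (norm_avg_sq_le _).trans ((sqn_stackGrad_sub_le hf _ _).trans (le_of_eq ?_))
    congr 1
    simp only [sqn, dev, hz, Pi.sub_apply, norm_sub_rev]
  -- The exact step contracts by `1 - 2aμ + a²L² ≤ 1 - 7/4 aμ`; the weight `aμ/2` still leaves the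
  -- rate `aμ`, with no loss of constant, as the threshold on `αγμ` in the second case demands.
  have hY := norm_add_sq_le_young (e - a • m) (a • avg (stackGrad f z - stackGrad f x))
    (c := a * μ / 2) (by positivity)
  rw [← hsplit, norm_sub_sq_real e, inner_smul_right, norm_smul, norm_smul,
    Real.norm_of_nonneg ha.le, real_inner_comm] at hY
  have hn : (0 : ℝ) ≤ n := Nat.cast_nonneg n
  have hY2 := mul_le_mul_of_nonneg_left hY hn
  set D := ‖avg (stackGrad f z - stackGrad f x)‖
  set E := (n : ℝ) * ‖e‖ ^ 2 with hE
  have hE0 : 0 ≤ E := by positivity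
  have hX0 := sqn_nonneg (dev x)
  have e1 : n * ((1 + a * μ / 2) * (‖e‖ ^ 2 - 2 * (a * inner ℝ m e) + (a * ‖m‖) ^ 2)
      + (1 + 1 / (a * μ / 2)) * (a * D) ^ 2)
      = (1 + a * μ / 2) * (E - 2 * a * (n * inner ℝ m e) + a ^ 2 * (n * ‖m‖ ^ 2))
        + (a ^ 2 + 2 * a / μ) * (n * D ^ 2) := by
    rw [hE]; field_simp
  rw [e1] at hY2
  have k1 : (1 + a * μ / 2) * (E - 2 * a * (n * inner ℝ m e) + a ^ 2 * (n * ‖m‖ ^ 2))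
      ≤ (1 + a * μ / 2) * (E - 2 * a * (μ * E) + a ^ 2 * (L ^ 2 * E)) := by
    have : μ * E ≤ n * inner ℝ m e := by rw [hE]; linarith
    gcongr
  have k2 : (a ^ 2 + 2 * a / μ) * (n * D ^ 2) ≤ (a ^ 2 + 2 * a / μ) * (L ^ 2 * sqn (dev x)) := by
    gcongr
  have k3 : (a ^ 2 + 2 * a / μ) * (L ^ 2 * sqn (dev x))
      ≤ 3 * L ^ 2 / μ * a * sqn (dev x) := by
    have : a ^ 2 + 2 * a / μ ≤ 3 * a / μ := by
      rw [add_div' _ _ _ hμ.ne', div_le_div_iff_of_pos_right hμ]; nlinarith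
    calc _ ≤ 3 * a / μ * (L ^ 2 * sqn (dev x)) := by gcongr
      _ = _ := by ring
  have k4 : (1 + a * μ / 2) * (E - 2 * a * (μ * E) + a ^ 2 * (L ^ 2 * E)) ≤ (1 - a * μ) * E := by
    have p0 : (1 + a * μ / 2) * (1 - 2 * (a * μ) + a * (a * L ^ 2)) ≤ 1 - a * μ := by
      have p1 : a * (a * L ^ 2) ≤ a * (μ / 4) := by gcongr
      have p2 : (1 + a * μ / 2) * (1 - 2 * (a * μ) + a * (a * L ^ 2))
          ≤ (1 + a * μ / 2) * (1 - 2 * (a * μ) + a * (μ / 4)) := by gcongr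
      have p3 : 0 < a * μ := by positivity
      nlinarith
    calc _ = (1 + a * μ / 2) * (1 - 2 * (a * μ) + a * (a * L ^ 2)) * E := by ring
      _ ≤ _ := by gcongr
  linarith

lemma sqn_stackGrad_le [NeZero n] {μ L : ℝ} (hf : IsObjective f μ L) (xstar : Vec r)
    (x : Fin n → Vec r) :
    sqn (stackGrad f x) ≤ 2 * L ^ 2 * (n * ‖avg x - xstar‖ ^ 2 + sqn (dev x))
      + 2 * sqn (stackGrad f fun _ => xstar) := by
  have h := sqn_add_le (stackGrad f x - stackGrad f fun _ => xstar) (stackGrad f fun _ => xstar)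
    one_pos
  rw [sub_add_cancel] at h
  have h2 := sqn_stackGrad_sub_le hf x fun _ => xstar
  rw [sqn_sub_const] at h2
  linarith

/-- The consensus and tracking errors contract up to terms of the order of the squared stepsize. -/
lemma exists_consensus_contraction (hW : IsCoupling W) {μ L α : ℝ} (hα : 0 < α)
    (hf : IsObjective f μ L) (xstar : Vec r) :
    ∃ b c C : ℝ, 0 < b ∧ 0 < c ∧ c ≤ 1 ∧ 0 < C ∧ ∀ (γ : ℝ) (s x : Fin n → Vec r),
      sqn (dev (meanX W f α γ s x)) + b * sqn (dev (meanS W f γ s x) - 0)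
        ≤ (1 - c) * (sqn (dev x) + b * sqn (dev s - 0))
          + C * γ ^ 2 * (n * ‖avg x - xstar‖ ^ 2 + sqn (dev x) + 1) := by
  have := neZero_of_isCoupling hW
  have hρ0 := rhoW_nonneg W
  set ρ := rhoW W with hρ
  have hδ : 0 < 1 - ρ := by have := rhoW_lt_one hW; linarith
  set b0 := sqn (stackGrad f fun _ => xstar) with hb0
  have hb0' : 0 ≤ b0 := sqn_nonneg _
  -- With this `b`, tracking feeds `(1 - ρ)/2 · b S` into consensus, half of what the contraction of
  -- `b S` yields.
  set b := α ^ 2 * (4 * (1 + ρ) / (1 - ρ) ^ 2) with hb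
  have hbpos : 0 < b := by positivity
  set C1 := α ^ 2 * (2 / (1 - ρ) ^ 2) + b / (1 - ρ) with hC1
  have hC1pos : 0 < C1 := by positivity
  refine ⟨b, (1 - ρ) / 2, C1 * (2 * L ^ 2 + 2 * b0 + 1), hbpos, by positivity, by linarith,
    by positivity, fun γ s x => ?_⟩
  -- Reference point `t = 0` with `g = 0`: the full gradient counts as perturbation, harmless since
  -- it carries `γ²`.
  have ht : (0 : Fin n → Vec r) - mix W 0 = γ • dev 0 := by
    ext1 i; simp [mix, dev, avg]
  have ht0 : avg (0 : Fin n → Vec r) = 0 := by simp [avg]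
  have hS := sqn_dev_meanS_sub_le (f := f) hW ht0 ht s x
  have hX := sqn_dev_meanX_le (f := f) (α := α) hW ht0 ht s x
  rw [sub_zero (stackGrad f x), ← hρ] at hS hX
  set G := sqn (dev (stackGrad f x)) with hG
  have hGle : G ≤ 2 * L ^ 2 * (n * ‖avg x - xstar‖ ^ 2 + sqn (dev x)) + 2 * b0 :=
    (sqn_dev_le _).trans (sqn_stackGrad_le hf xstar x)
  have hX0 := sqn_nonneg (dev x)
  have hS0 := sqn_nonneg (dev s - 0)
  set X := sqn (dev x)
  set S := sqn (dev s - 0)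
  set E := (n : ℝ) * ‖avg x - xstar‖ ^ 2 with hE
  have hE0 : 0 ≤ E := by positivity
  have hbS := mul_le_mul_of_nonneg_left hS hbpos.le
  have e1 : α ^ 2 * (2 * (1 + ρ) * S + 2 / (1 - ρ) * (γ ^ 2 * G)) / (1 - ρ)
      = (1 - ρ) / 2 * (b * S) + α ^ 2 * (2 / (1 - ρ) ^ 2) * (γ ^ 2 * G) := by
    rw [hb]; field_simp; ring
  have e2 : b * (ρ * S + γ ^ 2 * G / (1 - ρ)) = ρ * (b * S) + b / (1 - ρ) * (γ ^ 2 * G) := by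
    ring
  rw [e1] at hX
  rw [e2] at hbS
  have hG2 : C1 * (γ ^ 2 * G) ≤ C1 * (2 * L ^ 2 + 2 * b0 + 1) * γ ^ 2 * (E + X + 1) := by
    have : G ≤ (2 * L ^ 2 + 2 * b0 + 1) * (E + X + 1) := by
      have i1 : 0 ≤ b0 * (E + X) := by positivity
      have i2 : 0 ≤ L ^ 2 := by positivity
      nlinarith
    calc C1 * (γ ^ 2 * G) ≤ C1 * (γ ^ 2 * ((2 * L ^ 2 + 2 * b0 + 1) * (E + X + 1))) := by gcongr
      _ = _ := by ring
  have e3 : C1 * (γ ^ 2 * G) = α ^ 2 * (2 / (1 - ρ) ^ 2) * (γ ^ 2 * G)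
      + b / (1 - ρ) * (γ ^ 2 * G) := by rw [hC1]; ring
  have hX2 : 0 ≤ (1 - ρ) * X := by positivity
  linarith

end

/-! ### Scalar recursions. -/

section Sequences

open Filter Topology

lemma tendsto_one_add_nat_rpow_neg {p : ℝ} (hp : 0 < p) :
    Tendsto (fun k : ℕ => 1 / (1 + (k : ℝ)) ^ p) atTop (𝓝 0) := by
  have h1 : Tendsto (fun k : ℕ => 1 + (k : ℝ)) atTop atTop :=
    tendsto_atTop_add_const_left _ _ tendsto_natCast_atTop_atTop
  simp only [one_div]
  exact ((tendsto_rpow_atTop hp).comp h1).inv_tendsto_atTop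

/-- The link is `1 - κ/t ≤ exp (-κ/t) ≤ (1 + 1/t)^(-κ)`. -/
lemma one_sub_div_mul_le {κ t : ℝ} (hκ : 0 ≤ κ) (ht : 1 ≤ t) :
    (1 - κ / t) * (1 / t ^ κ) ≤ 1 / (t + 1) ^ κ := by
  have ht0 : 0 < t := by linarith
  have h1 : (t + 1) ^ κ = t ^ κ * (1 + 1 / t) ^ κ := by
    rw [← Real.mul_rpow ht0.le (by positivity)]
    congr 1; field_simp
  have h2 : (1 + 1 / t) ^ κ ≤ Real.exp (κ / t) := by
    have h3 : 1 + 1 / t ≤ Real.exp (1 / t) := by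
      have := Real.add_one_le_exp (1 / t); linarith
    calc (1 + 1 / t) ^ κ ≤ Real.exp (1 / t) ^ κ :=
          Real.rpow_le_rpow (by positivity) h3 hκ
      _ = Real.exp (κ / t) := by rw [← Real.exp_mul]; congr 1; ring
  have h4 : 1 - κ / t ≤ Real.exp (-(κ / t)) := by
    have := Real.add_one_le_exp (-(κ / t)); linarith
  have h5 : Real.exp (-(κ / t)) ≤ 1 / (1 + 1 / t) ^ κ := by
    rw [Real.exp_neg, ← one_div]
    exact one_div_le_one_div_of_le (Real.rpow_pos_of_pos (by positivity) _) h2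
  have hpos : 0 < t ^ κ := Real.rpow_pos_of_pos ht0 _
  calc (1 - κ / t) * (1 / t ^ κ) ≤ 1 / (1 + 1 / t) ^ κ * (1 / t ^ κ) := by
        gcongr; exact h4.trans h5
    _ = 1 / (t + 1) ^ κ := by rw [h1, one_div_mul_one_div, mul_comm]

/-- A version of Chung's lemma. -/
lemma exists_le_div_rpow {v : ℕ → ℝ} {c D κ p δ : ℝ} (hv : ∀ k, 0 ≤ v k) (hκ : 0 ≤ κ) (hD : 0 ≤ D)
    (hδ : 0 < δ)
    (hrec : ∀ᶠ k : ℕ in atTop, v (k + 1) ≤ (1 - c * (1 / (1 + (k : ℝ)) ^ p)) * v k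
      + D * (1 / (1 + (k : ℝ)) ^ p * (1 / (1 + (k : ℝ)) ^ κ)))
    (h1 : ∀ᶠ k : ℕ in atTop, c * (1 / (1 + (k : ℝ)) ^ p) ≤ 1)
    (h2 : ∀ᶠ k : ℕ in atTop, κ / (1 + (k : ℝ)) + δ * (1 / (1 + (k : ℝ)) ^ p)
      ≤ c * (1 / (1 + (k : ℝ)) ^ p)) :
    ∃ C : ℝ, 0 ≤ C ∧ ∀ k : ℕ, v k ≤ C / (1 + (k : ℝ)) ^ κ := by
  obtain ⟨K, hK⟩ := eventually_atTop.1 (hrec.and (h1.and h2))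
  have ht : ∀ k : ℕ, 0 < (1 + (k : ℝ)) ^ κ := fun k => Real.rpow_pos_of_pos (by positivity) _
  -- The sum covers the indices up to `K`; `D / δ` lets the slack `δ` in the contraction absorb the
  -- forcing.
  set C := ∑ k ∈ Finset.range (K + 1), v k * (1 + (k : ℝ)) ^ κ + D / δ with hC
  have hsum : ∀ k ∈ Finset.range (K + 1), 0 ≤ v k * (1 + (k : ℝ)) ^ κ := fun k _ =>
    mul_nonneg (hv k) (ht k).le
  have hC0 : 0 ≤ C := add_nonneg (Finset.sum_nonneg hsum) (by positivity)
  have hCD : D ≤ C * δ := by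
    rw [← div_le_iff₀ hδ]
    linarith [Finset.sum_nonneg hsum]
  have hsmall : ∀ k, k ≤ K → v k ≤ C / (1 + (k : ℝ)) ^ κ := fun k hk => by
    rw [le_div_iff₀ (ht k)]
    have := Finset.single_le_sum hsum (Finset.mem_range.2 (Nat.lt_succ_of_le hk))
    have : 0 ≤ D / δ := by positivity
    linarith
  have hbig : ∀ k, K ≤ k → v k ≤ C / (1 + (k : ℝ)) ^ κ := by
    intro k hk
    induction k, hk using Nat.le_induction with
    | base => exact hsmall K le_rfl
    | succ k hk ih =>
      obtain ⟨a1, a2, a3⟩ := hK k hk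
      have hb := one_sub_div_mul_le hκ (t := 1 + (k : ℝ)) (by linarith [Nat.cast_nonneg (α := ℝ) k])
      set P := 1 / (1 + (k : ℝ)) ^ p
      have hP : 0 ≤ P := by positivity
      set Q := 1 / (1 + (k : ℝ)) ^ κ with hQ
      have hQ0 : 0 ≤ Q := by positivity
      have ih' : v k ≤ C * Q := by rw [hQ, mul_one_div]; exact ih
      have e : (1 + ((k + 1 : ℕ) : ℝ)) = 1 + (k : ℝ) + 1 := by push_cast; ring
      rw [e]
      calc v (k + 1) ≤ (1 - c * P) * v k + D * (P * Q) := a1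
        _ ≤ (1 - c * P) * (C * Q) + C * δ * (P * Q) := by
          have : 0 ≤ 1 - c * P := by linarith
          gcongr
        _ = C * ((1 - (c * P - δ * P)) * Q) := by ring
        _ ≤ C * ((1 - κ / (1 + (k : ℝ))) * Q) := by
          have : κ / (1 + (k : ℝ)) ≤ c * P - δ * P := by linarith
          gcongr
        _ ≤ C * (1 / (1 + (k : ℝ) + 1) ^ κ) := by gcongr
        _ = _ := by rw [mul_one_div]
  exact ⟨C, hC0, fun k => (le_total k K).elim (hsmall k) (hbig k)⟩

/-- Geometric contraction with a forcing term of polynomial decay. -/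
lemma exists_le_div_rpow_of_contraction {v : ℕ → ℝ} {c D κ : ℝ} (hv : ∀ k, 0 ≤ v k) (hκ : 0 ≤ κ)
    (hD : 0 ≤ D) (hc : 0 < c) (hc1 : c ≤ 1)
    (hrec : ∀ᶠ k : ℕ in atTop, v (k + 1) ≤ (1 - c) * v k + D * (1 / (1 + (k : ℝ)) ^ κ)) :
    ∃ C : ℝ, 0 ≤ C ∧ ∀ k : ℕ, v k ≤ C / (1 + (k : ℝ)) ^ κ := by
  refine exists_le_div_rpow (c := c) (D := D) (p := 0) (δ := c / 2) hv hκ hD (by positivity)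
    (by simpa using hrec) (Eventually.of_forall fun k => by simpa using hc1) ?_
  have h := (tendsto_one_add_nat_rpow_neg one_pos).const_mul κ
  rw [mul_zero] at h
  filter_upwards [h.eventually (ge_mem_nhds (show (0 : ℝ) < c / 2 by positivity))] with k hk
  simp only [Real.rpow_one, mul_one_div] at hk
  simp only [Real.rpow_zero, div_one, mul_one]
  linarith

lemma exists_le_of_summable {v d : ℕ → ℝ} (hv : ∀ k, 0 ≤ v k) (hd0 : ∀ k, 0 ≤ d k)
    (hd : Summable d) (hrec : ∀ᶠ k : ℕ in atTop, v (k + 1) ≤ v k + d k) :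
    ∃ C : ℝ, 0 ≤ C ∧ ∀ k : ℕ, v k ≤ C := by
  obtain ⟨K, hK⟩ := eventually_atTop.1 hrec
  have hbig : ∀ k, K ≤ k → v k ≤ v K + ∑ j ∈ Finset.range k, d j := by
    intro k hk
    induction k, hk using Nat.le_induction with
    | base => linarith [Finset.sum_nonneg fun j (_ : j ∈ Finset.range K) => hd0 j]
    | succ k hk ih =>
      rw [Finset.sum_range_succ]
      linarith [hK k hk]
  have hd1 : 0 ≤ ∑' j, d j := tsum_nonneg hd0
  refine ⟨∑ j ∈ Finset.range (K + 1), v j + ∑' j, d j,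
    add_nonneg (Finset.sum_nonneg fun j _ => hv j) hd1, fun k => ?_⟩
  have h1 : ∀ j, j ≤ K → v j ≤ ∑ j ∈ Finset.range (K + 1), v j := fun j hj =>
    Finset.single_le_sum (fun j _ => hv j) (Finset.mem_range.2 (Nat.lt_succ_of_le hj))
  rcases le_total k K with hk | hk
  · linarith [h1 k hk]
  · linarith [hbig k hk, h1 K le_rfl, hd.sum_le_tsum (Finset.range k) fun j _ => hd0 j]

lemma summable_one_div_one_add_rpow {p : ℝ} (hp : 1 < p) :
    Summable fun k : ℕ => 1 / (1 + (k : ℝ)) ^ p := by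
  have h := (summable_nat_add_iff 1).2 (Real.summable_one_div_nat_rpow.2 hp)
  refine h.congr fun k => ?_
  push_cast
  rw [add_comm]

end Sequences

/-! ### Square integrability and orthogonality in mean. -/

section SquareIntegrable

variable {Ω : Type*} [MeasurableSpace Ω] {P : Measure Ω}

/-- All agents' vectors are square integrable. -/
def IsL2 (P : Measure Ω) (Z : Ω → Fin n → Vec r) : Prop := ∀ i, MemLp (fun ω => Z ω i) 2 P

lemma IsL2.add {Y Z : Ω → Fin n → Vec r} (hY : IsL2 P Y) (hZ : IsL2 P Z) :
    IsL2 P fun ω => Y ω + Z ω := fun i => (hY i).add (hZ i)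

lemma IsL2.sub {Y Z : Ω → Fin n → Vec r} (hY : IsL2 P Y) (hZ : IsL2 P Z) :
    IsL2 P fun ω => Y ω - Z ω := fun i => (hY i).sub (hZ i)

lemma IsL2.smul {Z : Ω → Fin n → Vec r} (hZ : IsL2 P Z) (c : ℝ) :
    IsL2 P fun ω => c • Z ω := fun i => (hZ i).const_smul c

lemma IsL2.const [IsFiniteMeasure P] (z : Fin n → Vec r) : IsL2 P fun _ : Ω => z :=
  fun _ => memLp_const _

lemma IsL2.avg {Z : Ω → Fin n → Vec r} (hZ : IsL2 P Z) : MemLp (fun ω => avg (Z ω)) 2 P :=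
  (memLp_finsetSum Finset.univ fun i _ => hZ i).const_smul (1 / (n : ℝ))

lemma IsL2.dev {Z : Ω → Fin n → Vec r} (hZ : IsL2 P Z) : IsL2 P fun ω => dev (Z ω) :=
  fun i => (hZ i).sub hZ.avg

lemma IsL2.mix {Z : Ω → Fin n → Vec r} (hZ : IsL2 P Z) (W : Matrix (Fin n) (Fin n) ℝ) :
    IsL2 P fun ω => mix W (Z ω) :=
  fun i => memLp_finsetSum Finset.univ fun j _ => (hZ j).const_smul (W i j)

lemma IsL2.offMix {Z : Ω → Fin n → Vec r} (hZ : IsL2 P Z) (W : Matrix (Fin n) (Fin n) ℝ) :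
    IsL2 P fun ω => offMix W (Z ω) :=
  fun i => memLp_finsetSum (Finset.univ.erase i) fun j _ => (hZ j).const_smul (W i j)

lemma IsObjective.lipschitzWith {f : Fin n → Vec r → ℝ} {μ L : ℝ} (hf : IsObjective f μ L)
    (i : Fin n) : LipschitzWith (Real.nnabs L) (gradient (f i)) :=
  LipschitzWith.of_dist_le_mul fun x y => by
    rw [dist_eq_norm, dist_eq_norm, Real.coe_nnabs]
    exact (hf.lipschitz i x y).trans (by gcongr; exact le_abs_self L)

lemma IsL2.stackGrad [IsFiniteMeasure P] {Z : Ω → Fin n → Vec r} (hZ : IsL2 P Z)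
    {f : Fin n → Vec r → ℝ} {μ L : ℝ} (hf : IsObjective f μ L) :
    IsL2 P fun ω => stackGrad f (Z ω) := fun i => by
  have hl := hf.lipschitzWith i
  have h1 : MemLp (fun ω => gradient (f i) (Z ω i) - gradient (f i) 0) 2 P := by
    refine MemLp.of_le_mul (c := |L|) (hZ i) ?_ (Filter.Eventually.of_forall fun ω => ?_)
    · exact (hl.continuous.comp_aestronglyMeasurable (hZ i).1).sub aestronglyMeasurable_const
    · have := hl.dist_le_mul (Z ω i) 0
      rwa [dist_eq_norm, dist_eq_norm, Real.coe_nnabs, sub_zero] at this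
  have h2 := h1.add (memLp_const (gradient (f i) 0))
  refine h2.ae_eq (Filter.Eventually.of_forall fun ω => ?_)
  simp [GradTrack.stackGrad]

lemma integrable_norm_sq {Z : Ω → Vec r} (hZ : MemLp Z 2 P) :
    Integrable (fun ω => ‖Z ω‖ ^ 2) P := (memLp_two_iff_integrable_sq_norm hZ.1).1 hZ

lemma IsL2.integrable_sqn {Z : Ω → Fin n → Vec r} (hZ : IsL2 P Z) :
    Integrable (fun ω => sqn (Z ω)) P :=
  integrable_finsetSum _ fun i _ => integrable_norm_sq (hZ i)

/-- By independence the cross term is `⟨E D, E N⟩ = 0`. -/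
lemma integral_norm_add_sq [IsProbabilityMeasure P] {D N : Ω → Vec r} (hD : MemLp D 2 P)
    (hN : MemLp N 2 P) (hind : IndepFun D N P) (hN0 : ∫ ω, N ω ∂P = 0) :
    ∫ ω, ‖D ω + N ω‖ ^ 2 ∂P = ∫ ω, ‖D ω‖ ^ 2 ∂P + ∫ ω, ‖N ω‖ ^ 2 ∂P := by
  have hDi : Integrable D P := hD.integrable one_le_two
  have hNi : Integrable N P := hN.integrable one_le_two
  have h1 : ∫ ω, inner ℝ (D ω) (N ω) ∂P = 0 := by
    have := hind.integral_bilin hDi hNi (innerSL ℝ)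
    rw [hN0, map_zero] at this
    exact this
  have h2 : Integrable (fun ω => inner ℝ (D ω) (N ω)) P :=
    hind.integrable_bilin hDi hNi (innerSL ℝ)
  have h3 : ∀ ω, ‖D ω + N ω‖ ^ 2 = ‖D ω‖ ^ 2 + 2 * inner ℝ (D ω) (N ω) + ‖N ω‖ ^ 2 :=
    fun ω => norm_add_sq_real _ _
  simp only [h3]
  have h4 : Integrable (fun ω => ‖D ω‖ ^ 2 + 2 * inner ℝ (D ω) (N ω)) P :=
    (integrable_norm_sq hD).add (h2.const_mul 2)
  rw [integral_add h4 (integrable_norm_sq hN),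
    integral_add (integrable_norm_sq hD) (h2.const_mul 2), integral_const_mul, h1]
  ring

lemma integral_sqn_add [IsProbabilityMeasure P] {D N : Ω → Fin n → Vec r} (hD : IsL2 P D)
    (hN : IsL2 P N) (hind : IndepFun D N P) (hN0 : ∀ i, ∫ ω, N ω i ∂P = 0) :
    ∫ ω, sqn (D ω + N ω) ∂P = ∫ ω, sqn (D ω) ∂P + ∫ ω, sqn (N ω) ∂P := by
  have hDN := hD.add hN
  simp only [sqn]
  rw [integral_finsetSum _ fun i _ => integrable_norm_sq (hDN i),
    integral_finsetSum _ fun i _ => integrable_norm_sq (hD i),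
    integral_finsetSum _ fun i _ => integrable_norm_sq (hN i), ← Finset.sum_add_distrib]
  exact Finset.sum_congr rfl fun i _ => integral_norm_add_sq (hD i) (hN i)
    (hind.comp (measurable_pi_apply i) (measurable_pi_apply i)) (hN0 i)

end SquareIntegrable

/-! ### Past and present noise. -/

section NoiseAlgebra

variable {Ω : Type*} {η ξ : ℕ → Fin n → Ω → Vec r}

/-- The σ-algebra generated by the noise coordinates at the iterations in `T`. -/
@[reducible] def noiseAlgebra (η ξ : ℕ → Fin n → Ω → Vec r) (T : Set ℕ) : MeasurableSpace Ω :=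
  ⨆ t ∈ {t : ℕ × Fin n × Fin r | t.1 ∈ T}, MeasurableSpace.comap
    (fun ω => ((η t.1 t.2.1 ω t.2.2, ξ t.1 t.2.1 ω t.2.2) : ℝ × ℝ)) inferInstance

lemma noiseAlgebra_mono {S T : Set ℕ} (h : S ⊆ T) : noiseAlgebra η ξ S ≤ noiseAlgebra η ξ T :=
  biSup_mono fun _ ht => h ht

lemma measurable_noise_coord {T : Set ℕ} {k : ℕ} (hk : k ∈ T) (i : Fin n) (j : Fin r) :
    Measurable[noiseAlgebra η ξ T] fun ω => ((η k i ω j, ξ k i ω j) : ℝ × ℝ) := by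
  have h : MeasurableSpace.comap (fun ω => ((η k i ω j, ξ k i ω j) : ℝ × ℝ)) inferInstance
      ≤ noiseAlgebra η ξ T :=
    le_iSup₂_of_le (f := fun (t : ℕ × Fin n × Fin r) (_ : t ∈ {t : ℕ × Fin n × Fin r | t.1 ∈ T}) =>
      MeasurableSpace.comap
        (fun ω => ((η t.1 t.2.1 ω t.2.2, ξ t.1 t.2.1 ω t.2.2) : ℝ × ℝ)) inferInstance)
      (k, i, j) hk le_rfl
  exact (comap_measurable _).mono h le_rfl

/-- The noise of all agents at iteration `k`. -/
def noiseAt (η ξ : ℕ → Fin n → Ω → Vec r) (k : ℕ) (ω : Ω) : (Fin n → Vec r) × (Fin n → Vec r) :=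
  (fun i => η k i ω, fun i => ξ k i ω)

lemma measurable_noiseAt {T : Set ℕ} {k : ℕ} (hk : k ∈ T) :
    Measurable[noiseAlgebra η ξ T] (noiseAt η ξ k) := by
  let _ := noiseAlgebra η ξ T
  have h1 : ∀ i, Measurable[noiseAlgebra η ξ T] fun ω => η k i ω := fun i =>
    (WithLp.measurable_toLp 2 (Fin r → ℝ)).comp (measurable_pi_lambda _ fun j =>
      measurable_fst.comp (measurable_noise_coord (η := η) (ξ := ξ) hk i j))
  have h2 : ∀ i, Measurable[noiseAlgebra η ξ T] fun ω => ξ k i ω := fun i =>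
    (WithLp.measurable_toLp 2 (Fin r → ℝ)).comp (measurable_pi_lambda _ fun j =>
      measurable_snd.comp (measurable_noise_coord (η := η) (ξ := ξ) hk i j))
  exact Measurable.prodMk (measurable_pi_lambda _ h1) (measurable_pi_lambda _ h2)

end NoiseAlgebra

section Noise

variable {Ω : Type*} [MeasurableSpace Ω] {P : Measure Ω} {η ξ : ℕ → Fin n → Ω → Vec r} {ση σξ : ℝ}

lemma IsNoise.isL2_eta (h : IsNoise P η ξ ση σξ) (k : ℕ) : IsL2 P fun ω i => η k i ω := fun i => by
  rw [memLp_two_iff_integrable_sq_norm (h.measurable_eta k i).aestronglyMeasurable]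
  refine (h.integrable_eta k).mono'
    ((h.measurable_eta k i).norm.pow_const 2).aestronglyMeasurable
    (Filter.Eventually.of_forall fun ω => ?_)
  rw [Real.norm_of_nonneg (by positivity)]
  exact Finset.single_le_sum (f := fun i => ‖η k i ω‖ ^ 2) (fun i _ => by positivity)
    (Finset.mem_univ i)

lemma IsNoise.isL2_xi (h : IsNoise P η ξ ση σξ) (k : ℕ) : IsL2 P fun ω i => ξ k i ω := fun i => by
  rw [memLp_two_iff_integrable_sq_norm (h.measurable_xi k i).aestronglyMeasurable]
  refine (h.integrable_xi k).mono'
    ((h.measurable_xi k i).norm.pow_const 2).aestronglyMeasurable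
    (Filter.Eventually.of_forall fun ω => ?_)
  rw [Real.norm_of_nonneg (by positivity)]
  exact Finset.single_le_sum (f := fun i => ‖ξ k i ω‖ ^ 2) (fun i _ => by positivity)
    (Finset.mem_univ i)

lemma IsNoise.indep_noiseAlgebra (h : IsNoise P η ξ ση σξ) {S T : Set ℕ} (hST : Disjoint S T) :
    Indep (noiseAlgebra η ξ S) (noiseAlgebra η ξ T) P := by
  refine indep_iSup_of_disjoint (fun t => ?_) h.indep ?_
  · refine Measurable.comap_le ?_
    have h1 : Measurable fun v : Vec r => v t.2.2 := by fun_prop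
    exact (h1.comp (h.measurable_eta _ _)).prodMk (h1.comp (h.measurable_xi _ _))
  · rw [Set.disjoint_left] at hST ⊢
    exact fun t ht => hST ht

end Noise

/-! ### The random iterates and their mean-square errors. -/

section Iterates

variable {Ω : Type*} {W : Matrix (Fin n) (Fin n) ℝ} {f : Fin n → Vec r → ℝ} {α : ℝ} {γ β : ℕ → ℝ}
  {s₀ x₀ : Fin n → Vec r} {η ξ : ℕ → Fin n → Ω → Vec r}

/-- The random iterates `(s_k, x_k)`. -/
noncomputable def state (W : Matrix (Fin n) (Fin n) ℝ) (f : Fin n → Vec r → ℝ) (α : ℝ)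
    (γ β : ℕ → ℝ) (s₀ x₀ : Fin n → Vec r) (η ξ : ℕ → Fin n → Ω → Vec r) (k : ℕ) (ω : Ω) :
    (Fin n → Vec r) × (Fin n → Vec r) :=
  iterate W f α γ β s₀ x₀ (fun l i => η l i ω) (fun l i => ξ l i ω) k

lemma state_succ_fst (k : ℕ) (ω : Ω) :
    (state W f α γ β s₀ x₀ η ξ (k + 1) ω).1
      = meanS W f (γ k) (state W f α γ β s₀ x₀ η ξ k ω).1 (state W f α γ β s₀ x₀ η ξ k ω).2
        + β k • offMix W (noiseAt η ξ k ω).1 := nextS_eq_meanS_add ..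

lemma state_succ_snd (k : ℕ) (ω : Ω) :
    (state W f α γ β s₀ x₀ η ξ (k + 1) ω).2
      = meanX W f α (γ k) (state W f α γ β s₀ x₀ η ξ k ω).1 (state W f α γ β s₀ x₀ η ξ k ω).2
        + β k • (offMix W (noiseAt η ξ k ω).2 - α • offMix W (noiseAt η ξ k ω).1) :=
  nextX_eq_meanX_add ..

lemma continuous_mix (W : Matrix (Fin n) (Fin n) ℝ) :
    Continuous (mix W : (Fin n → Vec r) → Fin n → Vec r) := by
  unfold mix; fun_prop

lemma continuous_offMix (W : Matrix (Fin n) (Fin n) ℝ) :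
    Continuous (offMix W : (Fin n → Vec r) → Fin n → Vec r) := by
  unfold offMix; fun_prop

lemma continuous_avg : Continuous (avg : (Fin n → Vec r) → Vec r) := by
  unfold avg; fun_prop

lemma continuous_dev : Continuous (dev : (Fin n → Vec r) → Fin n → Vec r) := by
  unfold dev
  have := continuous_avg (n := n) (r := r)
  fun_prop

lemma continuous_meanS {μ L : ℝ} (hf : IsObjective f μ L) (c : ℝ) :
    Continuous fun z : (Fin n → Vec r) × (Fin n → Vec r) => meanS W f c z.1 z.2 := by
  have h1 := continuous_mix (r := r) W
  have h2 := fun i => (hf.lipschitzWith i).continuous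
  unfold meanS stackGrad
  fun_prop

lemma continuous_meanX {μ L : ℝ} (hf : IsObjective f μ L) (c : ℝ) :
    Continuous fun z : (Fin n → Vec r) × (Fin n → Vec r) => meanX W f α c z.1 z.2 := by
  have h1 := continuous_mix (r := r) W
  have h2 := continuous_meanS (W := W) hf c
  unfold meanX
  fun_prop

/-- The state at `k` uses only noise of iterations before `k`, which is what makes it independent of
the noise at `k`. -/
lemma measurable_state {μ L : ℝ} (hf : IsObjective f μ L) (k : ℕ) :
    Measurable[noiseAlgebra η ξ (Set.Iio k)] (state W f α γ β s₀ x₀ η ξ k) := by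
  induction k with
  | zero => exact measurable_const
  | succ k ih =>
    let _ := noiseAlgebra η ξ (Set.Iio (k + 1))
    have h1 : Measurable (state W f α γ β s₀ x₀ η ξ k) :=
      ih.mono (noiseAlgebra_mono fun l hl => Set.mem_Iio.2 (lt_trans hl k.lt_succ_self)) le_rfl
    have h2 : Measurable (noiseAt η ξ k) := measurable_noiseAt (Set.mem_Iio.2 k.lt_succ_self)
    have h3 := (continuous_offMix (r := r) W).measurable
    have h4 : Measurable fun ω => offMix W (noiseAt η ξ k ω).1 := h3.comp h2.fst
    have h5 : Measurable fun ω => offMix W (noiseAt η ξ k ω).2 := h3.comp h2.snd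
    have hsm : ∀ (c : ℝ) {Z : Ω → Fin n → Vec r}, Measurable Z → Measurable fun ω => c • Z ω :=
      fun c _ hZ => (continuous_const_smul c).measurable.comp hZ
    refine Measurable.prod ?_ ?_
    · simp only [state_succ_fst]
      exact ((continuous_meanS hf _).measurable.comp h1).add (hsm (β k) h4)
    · simp only [state_succ_snd]
      exact ((continuous_meanX hf _).measurable.comp h1).add (hsm (β k) (h5.sub (hsm α h4)))

variable [MeasurableSpace Ω] {P : Measure Ω} {ση σξ : ℝ}

/-- The pair `(η_k, ξ_k)` is kept together, so correlation between `η` and `ξ` at one index does no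
harm. -/
lemma indepFun_state_noiseAt {μ L : ℝ} (hf : IsObjective f μ L) (h : IsNoise P η ξ ση σξ) (k : ℕ) :
    IndepFun (state W f α γ β s₀ x₀ η ξ k) (noiseAt η ξ k) P := by
  have hd : Disjoint (Set.Iio k) {k} := by simp
  refine (IndepFun_iff_Indep _ _ _).2 ?_
  exact indep_of_indep_of_le_left (indep_of_indep_of_le_right (h.indep_noiseAlgebra hd)
    (measurable_noiseAt (Set.mem_singleton k)).comap_le) (measurable_state hf k).comap_le

variable [IsProbabilityMeasure P]

lemma isL2_state {μ L : ℝ} (hf : IsObjective f μ L) (h : IsNoise P η ξ ση σξ) (k : ℕ) :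
    IsL2 P (fun ω => (state W f α γ β s₀ x₀ η ξ k ω).1) ∧
    IsL2 P (fun ω => (state W f α γ β s₀ x₀ η ξ k ω).2) := by
  induction k with
  | zero => exact ⟨IsL2.const s₀, IsL2.const x₀⟩
  | succ k ih =>
    have h1 : IsL2 P fun ω => (noiseAt η ξ k ω).1 := h.isL2_eta k
    have h2 : IsL2 P fun ω => (noiseAt η ξ k ω).2 := h.isL2_xi k
    have h3 : IsL2 P fun ω => meanS W f (γ k) (state W f α γ β s₀ x₀ η ξ k ω).1
        (state W f α γ β s₀ x₀ η ξ k ω).2 := (ih.1.mix W).add ((ih.2.stackGrad hf).smul _)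
    have h4 : IsL2 P fun ω => meanX W f α (γ k) (state W f α γ β s₀ x₀ η ξ k ω).1
        (state W f α γ β s₀ x₀ η ξ k ω).2 := (ih.2.mix W).sub ((h3.sub ih.1).smul _)
    simp only [state_succ_fst, state_succ_snd]
    exact ⟨h3.add ((h1.offMix W).smul _),
      h4.add (((h2.offMix W).sub ((h1.offMix W).smul _)).smul _)⟩

lemma integral_offMix_eq_zero {Z : Ω → Fin n → Vec r} (hZ : IsL2 P Z)
    (h0 : ∀ i, ∫ ω, Z ω i ∂P = 0) (W : Matrix (Fin n) (Fin n) ℝ) (i : Fin n) :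
    ∫ ω, offMix W (Z ω) i ∂P = 0 := by
  simp only [offMix]
  have hi : ∀ j ∈ Finset.univ.erase i, Integrable (fun ω => W i j • Z ω j) P :=
    fun j _ => ((hZ j).integrable one_le_two).smul (W i j)
  rw [integral_finsetSum _ hi]
  simp [integral_smul, h0]

lemma integral_avg_eq_zero {Z : Ω → Fin n → Vec r} (hZ : IsL2 P Z)
    (h0 : ∀ i, ∫ ω, Z ω i ∂P = 0) : ∫ ω, avg (Z ω) ∂P = 0 := by
  simp only [avg]
  rw [integral_smul, integral_finsetSum _ fun j _ => (hZ j).integrable one_le_two]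
  simp [h0]

lemma integral_dev_eq_zero {Z : Ω → Fin n → Vec r} (hZ : IsL2 P Z)
    (h0 : ∀ i, ∫ ω, Z ω i ∂P = 0) (i : Fin n) : ∫ ω, dev (Z ω) i ∂P = 0 := by
  simp only [dev]
  rw [integral_sub ((hZ i).integrable one_le_two) (hZ.avg.integrable one_le_two), h0,
    integral_avg_eq_zero hZ h0, sub_zero]

/-- Weighted mean-square errors obey, up to the variance of the noise, every affine recursion that
holds for the noise-free update. -/
lemma error_recursion (hW : IsCoupling W) {μ L : ℝ} (hf : IsObjective f μ L)
    (h : IsNoise P η ξ ση σξ) (xstar : Vec r) (t : Fin n → Vec r) (k : ℕ) {a₁ a₂ a₃ c₁ c₂ c₃ d : ℝ}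
    (ha₁ : 0 ≤ a₁) (ha₂ : 0 ≤ a₂) (ha₃ : 0 ≤ a₃)
    (hstep : ∀ s x : Fin n → Vec r, a₁ * (n * ‖avg (meanX W f α (γ k) s x) - xstar‖ ^ 2)
        + a₂ * sqn (dev (meanX W f α (γ k) s x)) + a₃ * sqn (dev (meanS W f (γ k) s x) - t)
      ≤ c₁ * (n * ‖avg x - xstar‖ ^ 2) + c₂ * sqn (dev x) + c₃ * sqn (dev s - t) + d) :
    a₁ * ∫ ω, n * ‖avg (state W f α γ β s₀ x₀ η ξ (k + 1) ω).2 - xstar‖ ^ 2 ∂P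
      + a₂ * ∫ ω, sqn (dev (state W f α γ β s₀ x₀ η ξ (k + 1) ω).2) ∂P
      + a₃ * ∫ ω, sqn (dev (state W f α γ β s₀ x₀ η ξ (k + 1) ω).1 - t) ∂P
    ≤ c₁ * ∫ ω, n * ‖avg (state W f α γ β s₀ x₀ η ξ k ω).2 - xstar‖ ^ 2 ∂P
      + c₂ * ∫ ω, sqn (dev (state W f α γ β s₀ x₀ η ξ k ω).2) ∂P
      + c₃ * ∫ ω, sqn (dev (state W f α γ β s₀ x₀ η ξ k ω).1 - t) ∂P + d
      + (a₁ + a₂ + a₃) * (n ^ 2 * (2 * σξ ^ 2 + (2 * α ^ 2 + 1) * ση ^ 2)) * β k ^ 2 := by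
  have := neZero_of_isCoupling hW
  set st := state W f α γ β s₀ x₀ η ξ k with hst
  obtain ⟨hs, hx⟩ := isL2_state (W := W) (α := α) (γ := γ) (β := β) (s₀ := s₀) (x₀ := x₀) hf h k
  rw [← hst] at hs hx
  have hη : IsL2 P fun ω => offMix W (noiseAt η ξ k ω).1 := IsL2.offMix (h.isL2_eta k) W
  have hξ : IsL2 P fun ω => offMix W (noiseAt η ξ k ω).2 := IsL2.offMix (h.isL2_xi k) W
  have hη0 : ∀ i, ∫ ω, offMix W (noiseAt η ξ k ω).1 i ∂P = 0 :=
    integral_offMix_eq_zero (h.isL2_eta k) (h.mean_eta k) W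
  have hξ0 : ∀ i, ∫ ω, offMix W (noiseAt η ξ k ω).2 i ∂P = 0 :=
    integral_offMix_eq_zero (h.isL2_xi k) (h.mean_xi k) W
  have hηv : ∫ ω, sqn (offMix W (noiseAt η ξ k ω).1) ∂P ≤ n ^ 2 * ση ^ 2 := by
    refine (integral_mono hη.integrable_sqn ((h.integrable_eta k).const_mul _)
      fun ω => sqn_offMix_le hW _).trans ?_
    rw [integral_const_mul]
    gcongr
    exact h.variance_eta k
  have hξv : ∫ ω, sqn (offMix W (noiseAt η ξ k ω).2) ∂P ≤ n ^ 2 * σξ ^ 2 := by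
    refine (integral_mono hξ.integrable_sqn ((h.integrable_xi k).const_mul _)
      fun ω => sqn_offMix_le hW _).trans ?_
    rw [integral_const_mul]
    gcongr
    exact h.variance_xi k
  -- the noise terms
  let Ns : (Fin n → Vec r) × (Fin n → Vec r) → Fin n → Vec r := fun w => β k • offMix W w.1
  let Nx : (Fin n → Vec r) × (Fin n → Vec r) → Fin n → Vec r :=
    fun w => β k • (offMix W w.2 - α • offMix W w.1)
  have hNs : IsL2 P fun ω => Ns (noiseAt η ξ k ω) := hη.smul _
  have hNx : IsL2 P fun ω => Nx (noiseAt η ξ k ω) := (hξ.sub (hη.smul _)).smul _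
  have hNs0 : ∀ i, ∫ ω, Ns (noiseAt η ξ k ω) i ∂P = 0 := fun i => by
    simp only [Ns, Pi.smul_apply]
    rw [integral_smul, hη0, smul_zero]
  have hNx0 : ∀ i, ∫ ω, Nx (noiseAt η ξ k ω) i ∂P = 0 := fun i => by
    simp only [Nx, Pi.smul_apply, Pi.sub_apply]
    have hi : Integrable (fun ω => α • offMix W (noiseAt η ξ k ω).1 i) P :=
      ((hη i).integrable one_le_two).smul α
    rw [integral_smul, integral_sub ((hξ i).integrable one_le_two) hi, integral_smul, hη0, hξ0]
    simp
  have hcont := continuous_offMix (r := r) W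
  have hNsm : Measurable Ns := by
    have : Continuous Ns := by simp only [Ns]; fun_prop
    exact this.measurable
  have hNxm : Measurable Nx := by
    have : Continuous Nx := by simp only [Nx]; fun_prop
    exact this.measurable
  -- One constant for both noise terms: `n² ση²` in `s`, and `2 n² σξ² + 2 α² n² ση²` in `x`.
  set K := (n : ℝ) ^ 2 * (2 * σξ ^ 2 + (2 * α ^ 2 + 1) * ση ^ 2) with hK
  have hNsv : ∫ ω, sqn (Ns (noiseAt η ξ k ω)) ∂P ≤ K * β k ^ 2 := by
    simp only [Ns, sqn_smul]
    rw [integral_const_mul, mul_comm]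
    gcongr
    refine hηv.trans ?_
    rw [hK]
    have : 0 ≤ 2 * σξ ^ 2 + 2 * α ^ 2 * ση ^ 2 := by positivity
    gcongr
    linarith
  have hNxv : ∫ ω, sqn (Nx (noiseAt η ξ k ω)) ∂P ≤ K * β k ^ 2 := by
    simp only [Nx, sqn_smul]
    rw [integral_const_mul, mul_comm]
    gcongr
    have h1 : ∀ ω, sqn (offMix W (noiseAt η ξ k ω).2 - α • offMix W (noiseAt η ξ k ω).1)
        ≤ 2 * sqn (offMix W (noiseAt η ξ k ω).2)
          + 2 * α ^ 2 * sqn (offMix W (noiseAt η ξ k ω).1) := fun ω => by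
      have := sqn_sub_le (offMix W (noiseAt η ξ k ω).2) (α • offMix W (noiseAt η ξ k ω).1) one_pos
      rw [sqn_smul] at this
      linarith
    refine (integral_mono (hξ.sub (hη.smul α)).integrable_sqn
      ((hξ.integrable_sqn.const_mul 2).add (hη.integrable_sqn.const_mul (2 * α ^ 2))) h1).trans ?_
    simp only [Pi.add_apply]
    rw [integral_add (hξ.integrable_sqn.const_mul 2) (hη.integrable_sqn.const_mul (2 * α ^ 2)),
      integral_const_mul, integral_const_mul, hK]
    have i1 := mul_le_mul_of_nonneg_left hηv (show 0 ≤ 2 * α ^ 2 by positivity)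
    have i2 : 0 ≤ (n : ℝ) ^ 2 * ση ^ 2 := by positivity
    linarith
  -- the noise-free updates
  have hmS : IsL2 P fun ω => meanS W f (γ k) (st ω).1 (st ω).2 :=
    (hs.mix W).add ((hx.stackGrad hf).smul _)
  have hmX : IsL2 P fun ω => meanX W f α (γ k) (st ω).1 (st ω).2 :=
    (hx.mix W).sub ((hmS.sub hs).smul _)
  have hind := indepFun_state_noiseAt (W := W) (α := α) (γ := γ) (β := β) (s₀ := s₀) (x₀ := x₀)
    hf h k
  rw [← hst] at hind
  have hcS := continuous_meanS (W := W) hf (γ k)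
  have hcX := continuous_meanX (W := W) (α := α) hf (γ k)
  have hcd := continuous_dev (n := n) (r := r)
  have hca := continuous_avg (n := n) (r := r)
  -- the three errors after one step
  have e₁ : ∫ ω, n * ‖avg (state W f α γ β s₀ x₀ η ξ (k + 1) ω).2 - xstar‖ ^ 2 ∂P
      ≤ ∫ ω, n * ‖avg (meanX W f α (γ k) (st ω).1 (st ω).2) - xstar‖ ^ 2 ∂P + K * β k ^ 2 := by
    have h1 : ∀ ω, avg (state W f α γ β s₀ x₀ η ξ (k + 1) ω).2 - xstar
        = (avg (meanX W f α (γ k) (st ω).1 (st ω).2) - xstar) + avg (Nx (noiseAt η ξ k ω)) :=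
      fun ω => by rw [state_succ_snd, avg_add]; abel
    have hφ : Measurable fun z : (Fin n → Vec r) × (Fin n → Vec r) =>
        avg (meanX W f α (γ k) z.1 z.2) - xstar :=
      ((hca.comp hcX).sub continuous_const).measurable
    have h2 := integral_norm_add_sq (hmX.avg.sub (memLp_const xstar)) hNx.avg
      (hind.comp hφ (hca.measurable.comp hNxm)) (integral_avg_eq_zero hNx hNx0)
    simp only [h1, integral_const_mul]
    have h3 : (n : ℝ) * ∫ ω, ‖avg (Nx (noiseAt η ξ k ω))‖ ^ 2 ∂P ≤ K * β k ^ 2 := by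
      rw [← integral_const_mul]
      exact (integral_mono ((integrable_norm_sq hNx.avg).const_mul _) hNx.integrable_sqn
        fun ω => norm_avg_sq_le _).trans hNxv
    have h4 := congrArg (fun y => (n : ℝ) * y) h2
    simp only [Pi.sub_apply, mul_add] at h4
    linarith
  have e₂ : ∫ ω, sqn (dev (state W f α γ β s₀ x₀ η ξ (k + 1) ω).2) ∂P
      ≤ ∫ ω, sqn (dev (meanX W f α (γ k) (st ω).1 (st ω).2)) ∂P + K * β k ^ 2 := by
    have h1 : ∀ ω, dev (state W f α γ β s₀ x₀ η ξ (k + 1) ω).2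
        = dev (meanX W f α (γ k) (st ω).1 (st ω).2) + dev (Nx (noiseAt η ξ k ω)) :=
      fun ω => by rw [state_succ_snd, dev_add]
    have h2 := integral_sqn_add hmX.dev hNx.dev
      (hind.comp (hcd.comp hcX).measurable (hcd.measurable.comp hNxm))
      (integral_dev_eq_zero hNx hNx0)
    simp only [h1]
    have h3 : ∫ ω, sqn (dev (Nx (noiseAt η ξ k ω))) ∂P ≤ K * β k ^ 2 :=
      (integral_mono hNx.dev.integrable_sqn hNx.integrable_sqn fun ω => sqn_dev_le _).trans hNxv
    linarith
  have e₃ : ∫ ω, sqn (dev (state W f α γ β s₀ x₀ η ξ (k + 1) ω).1 - t) ∂P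
      ≤ ∫ ω, sqn (dev (meanS W f (γ k) (st ω).1 (st ω).2) - t) ∂P + K * β k ^ 2 := by
    have h1 : ∀ ω, dev (state W f α γ β s₀ x₀ η ξ (k + 1) ω).1 - t
        = (dev (meanS W f (γ k) (st ω).1 (st ω).2) - t) + dev (Ns (noiseAt η ξ k ω)) :=
      fun ω => by rw [state_succ_fst, dev_add]; abel
    have h2 := integral_sqn_add (hmS.dev.sub (IsL2.const t)) hNs.dev
      (hind.comp ((hcd.comp hcS).sub continuous_const).measurable (hcd.measurable.comp hNsm))
      (integral_dev_eq_zero hNs hNs0)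
    simp only [h1]
    have h3 : ∫ ω, sqn (dev (Ns (noiseAt η ξ k ω))) ∂P ≤ K * β k ^ 2 :=
      (integral_mono hNs.dev.integrable_sqn hNs.integrable_sqn fun ω => sqn_dev_le _).trans hNsv
    linarith
  have i₁ : Integrable (fun ω => n * ‖avg (meanX W f α (γ k) (st ω).1 (st ω).2) - xstar‖ ^ 2) P :=
    (integrable_norm_sq (hmX.avg.sub (memLp_const xstar))).const_mul _
  have i₂ := hmX.dev.integrable_sqn
  have i₃ := (hmS.dev.sub (IsL2.const t)).integrable_sqn
  have j₁ : Integrable (fun ω => n * ‖avg (st ω).2 - xstar‖ ^ 2) P :=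
    (integrable_norm_sq (hx.avg.sub (memLp_const xstar))).const_mul _
  have j₂ := hx.dev.integrable_sqn
  have j₃ := (hs.dev.sub (IsL2.const t)).integrable_sqn
  have hint := integral_mono (((i₁.const_mul a₁).add (i₂.const_mul a₂)).add (i₃.const_mul a₃))
    ((((j₁.const_mul c₁).add (j₂.const_mul c₂)).add (j₃.const_mul c₃)).add (integrable_const d))
    fun ω => hstep (st ω).1 (st ω).2
  rw [integral_add' ((i₁.const_mul a₁).add (i₂.const_mul a₂)) (i₃.const_mul a₃),
    integral_add' (i₁.const_mul a₁) (i₂.const_mul a₂),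
    integral_add' (((j₁.const_mul c₁).add (j₂.const_mul c₂)).add (j₃.const_mul c₃))
      (integrable_const d),
    integral_add' ((j₁.const_mul c₁).add (j₂.const_mul c₂)) (j₃.const_mul c₃),
    integral_add' (j₁.const_mul c₁) (j₂.const_mul c₂)] at hint
  have m₁ := mul_le_mul_of_nonneg_left e₁ ha₁
  have m₂ := mul_le_mul_of_nonneg_left e₂ ha₂
  have m₃ := mul_le_mul_of_nonneg_left e₃ ha₃
  simp only [integral_const_mul, integral_const, probReal_univ, one_smul] at hint m₁ m₂ m₃ ⊢
  linarith

end Iterates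

/-! ### Rates from the coupled recursions. -/

section Rates

open Filter Topology

lemma one_div_rpow_anti {a b : ℝ} (h : a ≤ b) (k : ℕ) :
    1 / (1 + (k : ℝ)) ^ b ≤ 1 / (1 + (k : ℝ)) ^ a := by
  have h1 : (1 : ℝ) ≤ 1 + k := by linarith [Nat.cast_nonneg (α := ℝ) k]
  exact one_div_le_one_div_of_le (Real.rpow_pos_of_pos (by linarith) _)
    (Real.rpow_le_rpow_of_exponent_le h1 h)

lemma one_div_rpow_mul (a b : ℝ) (k : ℕ) :
    1 / (1 + (k : ℝ)) ^ a * (1 / (1 + (k : ℝ)) ^ b) = 1 / (1 + (k : ℝ)) ^ (a + b) := by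
  rw [one_div_mul_one_div, Real.rpow_add (by positivity)]

lemma one_div_rpow_sq (a : ℝ) (k : ℕ) :
    (1 / (1 + (k : ℝ)) ^ a) ^ 2 = 1 / (1 + (k : ℝ)) ^ (2 * a) := by
  rw [sq, one_div_rpow_mul, two_mul]

lemma one_div_succ_rpow_le {a : ℝ} (ha : 0 ≤ a) (k : ℕ) :
    1 / (1 + ((k + 1 : ℕ) : ℝ)) ^ a ≤ 1 / (1 + (k : ℝ)) ^ a := by
  refine one_div_le_one_div_of_le (Real.rpow_pos_of_pos (by positivity) _)
    (Real.rpow_le_rpow (by positivity) ?_ ha)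
  push_cast; linarith

/-- The coupled recursions satisfied by the optimality error `u`, the consensus error `v` and the
tracking error `w` for decaying stepsizes. -/
structure DecayRecursion (p q m b c C₁ C₂ K₁ K₂ : ℝ) (u v w : ℕ → ℝ) : Prop where
  u_nonneg : ∀ k, 0 ≤ u k
  v_nonneg : ∀ k, 0 ≤ v k
  w_nonneg : ∀ k, 0 ≤ w k
  m_pos : 0 < m
  b_pos : 0 < b
  c_pos : 0 < c
  c_le : c ≤ 1
  C₁_nonneg : 0 ≤ C₁
  C₂_nonneg : 0 ≤ C₂
  K₁_nonneg : 0 ≤ K₁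
  K₂_nonneg : 0 ≤ K₂
  rec_u : ∀ᶠ k : ℕ in atTop, u (k + 1) ≤ (1 - m * (1 / (1 + (k : ℝ)) ^ p)) * u k
    + C₁ * (1 / (1 + (k : ℝ)) ^ p) * v k + K₁ * (1 / (1 + (k : ℝ)) ^ (2 * q))
  rec_vw : ∀ k : ℕ, v (k + 1) + b * w (k + 1) ≤ (1 - c) * (v k + b * w k)
    + C₂ * (1 / (1 + (k : ℝ)) ^ (2 * p)) * (u k + v k + 1) + K₂ * (1 / (1 + (k : ℝ)) ^ (2 * q))

namespace DecayRecursion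

variable {p q m b c C₁ C₂ K₁ K₂ : ℝ} {u v w : ℕ → ℝ}

lemma eventually_mul_le (hp : 0 < p) (C : ℝ) {ε : ℝ} (hε : 0 < ε) :
    ∀ᶠ k : ℕ in atTop, C * (1 / (1 + (k : ℝ)) ^ p) ≤ ε := by
  have h := (tendsto_one_add_nat_rpow_neg hp).const_mul C
  rw [mul_zero] at h
  exact h.eventually (ge_mem_nhds hε)

/-- For large `k` the coupling terms are absorbed: `C₂ R² u` by half of the decay `m R u`, the terms
in `v` by the fixed contraction `c`. The loss of `m / 2` is irrelevant, since only boundedness is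
drawn from it. -/
lemma rec_sum (h : DecayRecursion p q m b c C₁ C₂ K₁ K₂ u v w) (hp : 0 < p) :
    ∀ᶠ k : ℕ in atTop, u (k + 1) + (v (k + 1) + b * w (k + 1))
      ≤ (1 - m / 2 * (1 / (1 + (k : ℝ)) ^ p)) * (u k + (v k + b * w k))
        + (C₂ * (1 / (1 + (k : ℝ)) ^ (2 * p)) + (K₁ + K₂) * (1 / (1 + (k : ℝ)) ^ (2 * q))) := by
  have hm := h.m_pos
  have hc := h.c_pos
  filter_upwards [h.rec_u, eventually_mul_le hp C₂ (show 0 < m / 2 by positivity),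
    eventually_mul_le hp C₁ (show 0 < c / 4 by positivity),
    eventually_mul_le hp C₂ (show 0 < c / 4 by positivity),
    eventually_mul_le hp (m / 2) (show 0 < c / 4 by positivity)] with k hu h1 h2 h3 h4
  have hvw := h.rec_vw k
  have hP1 : 1 / (1 + (k : ℝ)) ^ p ≤ 1 := by simpa using one_div_rpow_anti hp.le k
  rw [← one_div_rpow_sq] at hvw ⊢
  have hP0 : 0 ≤ 1 / (1 + (k : ℝ)) ^ p := by positivity
  set R := 1 / (1 + (k : ℝ)) ^ p
  have i1 : C₂ * R ^ 2 * u k ≤ m / 2 * R * u k := by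
    have := mul_le_mul_of_nonneg_right h1 (mul_nonneg hP0 (h.u_nonneg k))
    linarith
  have i2 : C₂ * R ^ 2 * v k ≤ c / 4 * v k := by
    have j1 := mul_le_mul_of_nonneg_right h3 (mul_nonneg hP0 (h.v_nonneg k))
    have j2 := mul_le_mul_of_nonneg_right hP1 (mul_nonneg hc.le (h.v_nonneg k))
    linarith
  have i3 := mul_le_mul_of_nonneg_right h2 (h.v_nonneg k)
  have hbw : 0 ≤ b * w k := mul_nonneg h.b_pos.le (h.w_nonneg k)
  have i4 := mul_le_mul_of_nonneg_right h4 (add_nonneg (h.v_nonneg k) hbw)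
  have i5 := mul_nonneg hc.le (h.v_nonneg k)
  have i6 := mul_nonneg hc.le hbw
  linarith

/-- For `p ≤ 1` the forcing is of the order of the decay `k^(-p)`, and Chung's lemma applies with
exponent `0`. For `p > 1` the forcing is summable, as `2q ≥ p > 1`. -/
lemma exists_bound (h : DecayRecursion p q m b c C₁ C₂ K₁ K₂ u v w) (hp : 0 < p)
    (hpq : p ≤ 2 * q) :
    ∃ M : ℝ, 0 ≤ M ∧ ∀ k, u k + (v k + b * w k) ≤ M := by
  have hm := h.m_pos
  have h0 : ∀ k, 0 ≤ u k + (v k + b * w k) := fun k =>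
    add_nonneg (h.u_nonneg k) (add_nonneg (h.v_nonneg k) (mul_nonneg h.b_pos.le (h.w_nonneg k)))
  have hK : 0 ≤ K₁ + K₂ := add_nonneg h.K₁_nonneg h.K₂_nonneg
  rcases le_or_gt p 1 with hp1 | hp1
  · have hrec : ∀ᶠ k : ℕ in atTop, u (k + 1) + (v (k + 1) + b * w (k + 1))
        ≤ (1 - m / 2 * (1 / (1 + (k : ℝ)) ^ p)) * (u k + (v k + b * w k))
          + (C₂ + (K₁ + K₂)) * (1 / (1 + (k : ℝ)) ^ p * (1 / (1 + (k : ℝ)) ^ (0 : ℝ))) := by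
      filter_upwards [h.rec_sum hp] with k hk
      refine hk.trans ?_
      have j1 := mul_le_mul_of_nonneg_left (one_div_rpow_anti (show p ≤ 2 * p by linarith) k)
        h.C₂_nonneg
      have j2 := mul_le_mul_of_nonneg_left (one_div_rpow_anti hpq k) hK
      simp only [Real.rpow_zero, div_one, mul_one]
      linarith
    obtain ⟨C, hC0, hC⟩ := exists_le_div_rpow (v := fun k => u k + (v k + b * w k)) (δ := m / 2)
      h0 le_rfl (add_nonneg h.C₂_nonneg hK) (by positivity) hrec
      (eventually_mul_le hp (m / 2) one_pos) (Eventually.of_forall fun k => by simp)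
    exact ⟨C, hC0, fun k => by simpa using hC k⟩
  · refine exists_le_of_summable h0 (d := fun k : ℕ => C₂ * (1 / (1 + (k : ℝ)) ^ (2 * p))
        + (K₁ + K₂) * (1 / (1 + (k : ℝ)) ^ (2 * q)))
      (fun k => add_nonneg (mul_nonneg h.C₂_nonneg (by positivity))
        (mul_nonneg hK (by positivity)))
      (((summable_one_div_one_add_rpow (by linarith)).mul_left _).add
        ((summable_one_div_one_add_rpow (by linarith)).mul_left _)) ?_
    filter_upwards [h.rec_sum hp] with k hk
    refine hk.trans ?_
    have := mul_nonneg (show 0 ≤ m / 2 * (1 / (1 + (k : ℝ)) ^ p) by positivity) (h0 k)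
    linarith

lemma exists_consensus_rate (h : DecayRecursion p q m b c C₁ C₂ K₁ K₂ u v w) (hp : 0 < p)
    (hpq : p ≤ 2 * q) :
    ∃ C : ℝ, 0 ≤ C ∧ ∀ k : ℕ, v k + b * w k ≤ C / (1 + (k : ℝ)) ^ (2 * min q p) := by
  obtain ⟨M, hM0, hM⟩ := h.exists_bound hp hpq
  have hmin : 0 ≤ min q p := le_min (by linarith) hp.le
  have hbw : ∀ k, 0 ≤ b * w k := fun k => mul_nonneg h.b_pos.le (h.w_nonneg k)
  refine exists_le_div_rpow_of_contraction (c := c) (D := C₂ * (M + 1) + K₂)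
    (fun k => add_nonneg (h.v_nonneg k) (hbw k)) (by linarith)
    (add_nonneg (mul_nonneg h.C₂_nonneg (by linarith)) h.K₂_nonneg) h.c_pos h.c_le
    (Eventually.of_forall fun k => (h.rec_vw k).trans ?_)
  have j1 := one_div_rpow_anti (show 2 * min q p ≤ 2 * p by linarith [min_le_right q p]) k
  have j2 := one_div_rpow_anti (show 2 * min q p ≤ 2 * q by linarith [min_le_left q p]) k
  have j3 : u k + v k + 1 ≤ M + 1 := by linarith [hM k, hbw k]
  have j4 : C₂ * (1 / (1 + (k : ℝ)) ^ (2 * p)) * (u k + v k + 1)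
      ≤ C₂ * (1 / (1 + (k : ℝ)) ^ (2 * min q p)) * (M + 1) := by
    have := h.C₂_nonneg
    have := h.u_nonneg k
    have := h.v_nonneg k
    gcongr
  have j5 := mul_le_mul_of_nonneg_left j2 h.K₂_nonneg
  linarith

/-- The consensus error is `O(k^(-2p))`, so the forcing is `O(k^(-p) k^(-κ))` with `κ = min (2q - p)
(2p)`. Since `1/k ≤ k^(-p)` for `p ≤ 1`, the assumption `κ < m` is the slack that Chung's lemma
needs, including at `p = 1`. -/
lemma exists_optimality_rate (h : DecayRecursion p q m b c C₁ C₂ K₁ K₂ u v w) (hp : 0 < p)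
    (hp1 : p ≤ 1) (hpq : p < q) (hκ : min (2 * q - p) (2 * p) < m) :
    ∃ C : ℝ, 0 ≤ C ∧ ∀ k : ℕ, u k ≤ C / (1 + (k : ℝ)) ^ min (2 * q - p) (2 * p) := by
  obtain ⟨C, hC0, hC⟩ := h.exists_consensus_rate hp (by linarith)
  rw [min_eq_right hpq.le] at hC
  have hκ0 : 0 ≤ min (2 * q - p) (2 * p) := le_min (by linarith) (by linarith)
  refine exists_le_div_rpow (c := m) (D := C₁ * C + K₁) (p := p)
    (δ := m - min (2 * q - p) (2 * p)) h.u_nonneg hκ0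
    (add_nonneg (mul_nonneg h.C₁_nonneg hC0) h.K₁_nonneg) (by linarith) ?_
    (eventually_mul_le hp m one_pos) (Eventually.of_forall fun k => ?_)
  · filter_upwards [h.rec_u] with k hk
    refine hk.trans ?_
    have hv : v k ≤ C * (1 / (1 + (k : ℝ)) ^ (min (2 * q - p) (2 * p))) := by
      have j1 : v k ≤ C / (1 + (k : ℝ)) ^ (2 * p) := by
        linarith [hC k, mul_nonneg h.b_pos.le (h.w_nonneg k)]
      rw [← mul_one_div] at j1
      exact j1.trans (mul_le_mul_of_nonneg_left (one_div_rpow_anti (min_le_right _ _) k) hC0)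
    have hq : 1 / (1 + (k : ℝ)) ^ (2 * q)
        ≤ 1 / (1 + (k : ℝ)) ^ p * (1 / (1 + (k : ℝ)) ^ min (2 * q - p) (2 * p)) := by
      rw [one_div_rpow_mul]
      exact one_div_rpow_anti (by linarith [min_le_left (2 * q - p) (2 * p)]) k
    have j2 := mul_le_mul_of_nonneg_left hv
      (mul_nonneg h.C₁_nonneg (show 0 ≤ 1 / (1 + (k : ℝ)) ^ p by positivity))
    have j3 := mul_le_mul_of_nonneg_left hq h.K₁_nonneg
    linarith
  · have j := one_div_rpow_anti hp1 k
    rw [Real.rpow_one] at j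
    have := mul_le_mul_of_nonneg_left j hκ0
    rw [mul_one_div] at this
    linarith

end DecayRecursion

end Rates

/-! ### Assembly of the three cases. -/

section Assembly

variable {Ω : Type*} [MeasurableSpace Ω] {P : Measure Ω} [IsProbabilityMeasure P]
  {W : Matrix (Fin n) (Fin n) ℝ} {f : Fin n → Vec r → ℝ} {μ L α : ℝ} {γ β : ℕ → ℝ}
  {s₀ x₀ : Fin n → Vec r} {η ξ : ℕ → Fin n → Ω → Vec r} {ση σξ : ℝ}

/-- The deviation of `y_k` is the difference of `dev s_{k+1} - t` and `dev s_k - t`, so `t` cancels;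
the factor `n ≥ 1` in the optimality error is dropped. -/
lemma errorsLE_of_le (hW : IsCoupling W) (hf : IsObjective f μ L) (h : IsNoise P η ξ ση σξ)
    {xstar : Vec r} {t : Fin n → Vec r} {k : ℕ} {cu cv cw cw' : ℝ}
    (hu : ∫ ω, n * ‖avg (state W f α γ β s₀ x₀ η ξ k ω).2 - xstar‖ ^ 2 ∂P ≤ cu)
    (hv : ∫ ω, sqn (dev (state W f α γ β s₀ x₀ η ξ k ω).2) ∂P ≤ cv)
    (hw : ∫ ω, sqn (dev (state W f α γ β s₀ x₀ η ξ k ω).1 - t) ∂P ≤ cw)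
    (hw' : ∫ ω, sqn (dev (state W f α γ β s₀ x₀ η ξ (k + 1) ω).1 - t) ∂P ≤ cw') :
    ErrorsLE P W f α γ β s₀ x₀ η ξ xstar k cu cv (2 * cw' + 2 * cw) := by
  have hn := neZero_of_isCoupling hW
  obtain ⟨hs, hx⟩ := isL2_state (W := W) (α := α) (γ := γ) (β := β) (s₀ := s₀) (x₀ := x₀) hf h k
  obtain ⟨hs', -⟩ :=
    isL2_state (W := W) (α := α) (γ := γ) (β := β) (s₀ := s₀) (x₀ := x₀) hf h (k + 1)
  have hi := integrable_norm_sq (hx.avg.sub (memLp_const xstar))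
  have ht := (hs.dev.sub (IsL2.const t)).integrable_sqn
  have ht' := (hs'.dev.sub (IsL2.const t)).integrable_sqn
  refine ⟨⟨hi, (integral_mono hi (hi.const_mul (n : ℝ)) fun ω => ?_).trans hu⟩,
    ⟨hx.dev.integrable_sqn, hv⟩, ⟨(hs'.sub hs).dev.integrable_sqn, ?_⟩⟩
  · have : (1 : ℝ) ≤ n := by exact_mod_cast Nat.one_le_iff_ne_zero.2 hn.out
    exact le_mul_of_one_le_left (by positivity) this
  · refine (integral_mono (hs'.sub hs).dev.integrable_sqn ((ht'.const_mul 2).add (ht.const_mul 2))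
      fun ω => ?_).trans ?_
    · have h1 := sqn_sub_le (dev (state W f α γ β s₀ x₀ η ξ (k + 1) ω).1 - t)
        (dev (state W f α γ β s₀ x₀ η ξ k ω).1 - t) one_pos
      rw [sub_sub_sub_cancel_right, ← dev_sub] at h1
      simp only [Pi.add_apply]
      linarith
    · rw [integral_add' (ht'.const_mul 2) (ht.const_mul 2), integral_const_mul, integral_const_mul]
      linarith

lemma stepSeq_one (γ p : ℝ) (k : ℕ) : stepSeq γ 1 p k = γ * (1 / (1 + (k : ℝ)) ^ p) := by
  rw [stepSeq, mul_one_div]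

lemma noiseSeq_one_sq (q : ℝ) (k : ℕ) : noiseSeq 1 q k ^ 2 = 1 / (1 + (k : ℝ)) ^ (2 * q) :=
  one_div_rpow_sq q k

/-- The claim for a constant stepsize. -/
lemma exists_rate_constant_step (hW : IsCoupling W) {γ₀ q : ℝ} (hμ : 0 < μ) (hα : 0 < α)
    (hγ : 0 < γ₀) (hq : 0 ≤ q) (hf : IsObjective f μ L) {xstar : Vec r} (hx : IsMinimizer f xstar)
    (h : IsNoise P η ξ ση σξ) (hb : StepBound W μ L (α * γ₀)) :
    ∃ C₁ C₂ C₃ : ℝ, ∀ k : ℕ,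
      ErrorsLE P W f α (stepSeq γ₀ 1 0) (noiseSeq 1 q) s₀ x₀ η ξ xstar k
        (C₁ / (1 + k) ^ (2 * q)) (C₂ / (1 + k) ^ (2 * q)) (C₃ / (1 + k) ^ (2 * q)) := by
  have := neZero_of_isCoupling hW
  obtain ⟨t, ht0, ht⟩ := exists_sub_mix_eq hW
    (g := γ₀ • dev (stackGrad f fun _ => xstar)) (by rw [avg_smul, avg_dev, smul_zero])
  obtain ⟨A, B, c, hA, hB, hc, hc1, hstep⟩ := lyap_contraction hW hμ hα hγ hf hx hb ht0 ht
  have hγk : ∀ k, stepSeq γ₀ 1 0 k = γ₀ := fun k => by simp [stepSeq]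
  set st := state W f α (stepSeq γ₀ 1 0) (noiseSeq 1 q) s₀ x₀ η ξ with hst
  set u : ℕ → ℝ := fun k => ∫ ω, n * ‖avg (st k ω).2 - xstar‖ ^ 2 ∂P with hu
  set v : ℕ → ℝ := fun k => ∫ ω, sqn (dev (st k ω).2) ∂P with hv
  set w : ℕ → ℝ := fun k => ∫ ω, sqn (dev (st k ω).1 - t) ∂P with hw
  have hu0 : ∀ k, 0 ≤ u k := fun k => integral_nonneg fun ω => by positivity
  have hv0 : ∀ k, 0 ≤ v k := fun k => integral_nonneg fun ω => sqn_nonneg _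
  have hw0 : ∀ k, 0 ≤ w k := fun k => integral_nonneg fun ω => sqn_nonneg _
  set K := (1 + A + B) * (n ^ 2 * (2 * σξ ^ 2 + (2 * α ^ 2 + 1) * ση ^ 2)) with hK
  have hrec : ∀ k : ℕ, u (k + 1) + A * v (k + 1) + B * w (k + 1)
      ≤ (1 - c) * (u k + A * v k + B * w k) + K * (1 / (1 + (k : ℝ)) ^ (2 * q)) := fun k => by
    have hr := error_recursion (γ := stepSeq γ₀ 1 0) (β := noiseSeq 1 q) (s₀ := s₀) (x₀ := x₀)
      (a₁ := 1) (a₂ := A) (a₃ := B) (c₁ := 1 - c) (c₂ := (1 - c) * A) (c₃ := (1 - c) * B) (d := 0)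
      hW hf h xstar t k zero_le_one hA.le hB.le (fun s x => by
        have := hstep s x
        simp only [lyap, consErr_eq] at this
        rw [hγk]
        linarith)
    rw [noiseSeq_one_sq] at hr
    simp only [hu, hv, hw, hst]
    linarith
  obtain ⟨C, hC0, hC⟩ := exists_le_div_rpow_of_contraction
    (fun k => add_nonneg (add_nonneg (hu0 k) (mul_nonneg hA.le (hv0 k)))
      (mul_nonneg hB.le (hw0 k))) (show 0 ≤ 2 * q by linarith) (by positivity) hc hc1
    (Filter.Eventually.of_forall hrec)
  have hwC : ∀ k, w k ≤ C / B * (1 / (1 + (k : ℝ)) ^ (2 * q)) := fun k => by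
    have h1 := hC k
    rw [← mul_one_div] at h1
    rw [div_mul_eq_mul_div, le_div_iff₀ hB]
    linarith [hu0 k, mul_nonneg hA.le (hv0 k)]
  -- The `4` is `2 + 2`, from the tracking errors at `k` and `k + 1`.
  refine ⟨C, C / A, 4 * (C / B), fun k => ?_⟩
  have e : 4 * (C / B) / (1 + (k : ℝ)) ^ (2 * q)
      = 2 * (C / B * (1 / (1 + (k : ℝ)) ^ (2 * q))) + 2 * (C / B * (1 / (1 + (k : ℝ)) ^ (2 * q))) := by
    ring
  rw [e]
  refine errorsLE_of_le (t := t) hW hf h ?_ ?_ (hwC k) ((hwC (k + 1)).trans ?_)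
  · exact le_trans (by linarith [mul_nonneg hA.le (hv0 k), mul_nonneg hB.le (hw0 k)]) (hC k)
  · change v k ≤ _
    have h1 := hC k
    rw [div_right_comm, le_div_iff₀ hA]
    linarith [hu0 k, mul_nonneg hB.le (hw0 k)]
  · exact mul_le_mul_of_nonneg_left (one_div_succ_rpow_le (by linarith) k) (by positivity)

/-- Decaying stepsizes: the errors are described by a `DecayRecursion`. -/
lemma exists_decayRecursion (hW : IsCoupling W) {γ₀ p q : ℝ} (hμ : 0 < μ) (hα : 0 < α)
    (hγ : 0 < γ₀) (hp : 0 < p) (hf : IsObjective f μ L) {xstar : Vec r}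
    (hx : IsMinimizer f xstar) (h : IsNoise P η ξ ση σξ) :
    ∃ b c C₁ C₂ K₁ K₂ : ℝ, ∃ u v w : ℕ → ℝ,
      DecayRecursion p q (α * γ₀ * μ) b c C₁ C₂ K₁ K₂ u v w ∧
      ∀ (k : ℕ) (cu cv cw cw' : ℝ), u k ≤ cu → v k ≤ cv → w k ≤ cw → w (k + 1) ≤ cw' →
        ErrorsLE P W f α (stepSeq γ₀ 1 p) (noiseSeq 1 q) s₀ x₀ η ξ xstar k cu cv
          (2 * cw' + 2 * cw) := by
  have := neZero_of_isCoupling hW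
  obtain ⟨b, c, C, hb, hc, hc1, hC, hcons⟩ := exists_consensus_contraction hW hα hf xstar
  set st := state W f α (stepSeq γ₀ 1 p) (noiseSeq 1 q) s₀ x₀ η ξ with hst
  set u : ℕ → ℝ := fun k => ∫ ω, n * ‖avg (st k ω).2 - xstar‖ ^ 2 ∂P with hu
  set v : ℕ → ℝ := fun k => ∫ ω, sqn (dev (st k ω).2) ∂P with hv
  set w : ℕ → ℝ := fun k => ∫ ω, sqn (dev (st k ω).1 - 0) ∂P with hw
  have hu0 : ∀ k, 0 ≤ u k := fun k => integral_nonneg fun ω => by positivity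
  have hv0 : ∀ k, 0 ≤ v k := fun k => integral_nonneg fun ω => sqn_nonneg _
  have hw0 : ∀ k, 0 ≤ w k := fun k => integral_nonneg fun ω => sqn_nonneg _
  set K := (n : ℝ) ^ 2 * (2 * σξ ^ 2 + (2 * α ^ 2 + 1) * ση ^ 2) with hK
  refine ⟨b, c, 3 * L ^ 2 / μ * (α * γ₀), C * γ₀ ^ 2, K, (1 + b) * K, u, v, w,
    ⟨hu0, hv0, hw0, by positivity, hb, hc, hc1, by positivity, by positivity, by positivity,
      by positivity, ?_, ?_⟩, fun k cu cv cw cw' h1 h2 h3 h4 => errorsLE_of_le hW hf h h1 h2 h3 h4⟩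
  -- The one-step estimate needs small steps, so this recursion holds only eventually.
  · filter_upwards [DecayRecursion.eventually_mul_le hp (α * γ₀ * L ^ 2)
        (show 0 < μ / 4 by positivity),
      DecayRecursion.eventually_mul_le hp (α * γ₀ * μ) one_pos] with k h1 h2
    have hP : 0 < 1 / (1 + (k : ℝ)) ^ p := by positivity
    have hr := error_recursion (γ := stepSeq γ₀ 1 p) (β := noiseSeq 1 q) (s₀ := s₀) (x₀ := x₀)
      (a₁ := 1) (a₂ := 0) (a₃ := 0) (c₁ := 1 - α * stepSeq γ₀ 1 p k * μ)
      (c₂ := 3 * L ^ 2 / μ * (α * stepSeq γ₀ 1 p k)) (c₃ := 0) (d := 0)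
      hW hf h xstar 0 k zero_le_one le_rfl le_rfl (fun s x => by
        have := dist_avg_meanX_le (α := α) (γ := stepSeq γ₀ 1 p k) hW hμ hf hx
          (by rw [stepSeq_one]; positivity) (by rw [stepSeq_one]; linarith)
          (by rw [stepSeq_one]; linarith) s x
        linarith)
    rw [noiseSeq_one_sq, stepSeq_one] at hr
    simp only [hu, hv, hst]
    linarith
  · intro k
    have hr := error_recursion (γ := stepSeq γ₀ 1 p) (β := noiseSeq 1 q) (s₀ := s₀) (x₀ := x₀)
      (a₁ := 0) (a₂ := 1) (a₃ := b) (c₁ := C * stepSeq γ₀ 1 p k ^ 2)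
      (c₂ := 1 - c + C * stepSeq γ₀ 1 p k ^ 2) (c₃ := (1 - c) * b)
      (d := C * stepSeq γ₀ 1 p k ^ 2)
      hW hf h xstar 0 k le_rfl zero_le_one hb.le (fun s x => by
        have := hcons (stepSeq γ₀ 1 p k) s x
        linarith)
    rw [noiseSeq_one_sq, stepSeq_one, mul_pow, one_div_rpow_sq] at hr
    simp only [hu, hv, hw, hst]
    linarith

/-- The consensus and tracking parts of the claim for decaying stepsizes. -/
lemma exists_rate_decaying_step {u v w : ℕ → ℝ} {p q m b c C₁ C₂ K₁ K₂ : ℝ}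
    (hrec : DecayRecursion p q m b c C₁ C₂ K₁ K₂ u v w) (hp : 0 < p) (hpq : p ≤ 2 * q)
    :
    ∃ C : ℝ, ∀ k : ℕ, v k ≤ C / (1 + (k : ℝ)) ^ (2 * min q p) ∧
      w k ≤ C / b * (1 / (1 + (k : ℝ)) ^ (2 * min q p)) ∧
      w (k + 1) ≤ C / b * (1 / (1 + (k : ℝ)) ^ (2 * min q p)) := by
  obtain ⟨C, hC0, hC⟩ := hrec.exists_consensus_rate hp hpq
  have hb := hrec.b_pos
  have hmin : 0 ≤ min q p := le_min (by linarith) hp.le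
  have hw : ∀ k : ℕ, w k ≤ C / b * (1 / (1 + (k : ℝ)) ^ (2 * min q p)) := fun k => by
    have h1 := hC k
    rw [← mul_one_div] at h1
    rw [div_mul_eq_mul_div, le_div_iff₀ hb]
    linarith [hrec.v_nonneg k]
  refine ⟨C, fun k => ⟨?_, hw k, (hw (k + 1)).trans ?_⟩⟩
  · linarith [hC k, mul_nonneg hb.le (hrec.w_nonneg k)]
  · exact mul_le_mul_of_nonneg_left (one_div_succ_rpow_le (by linarith) k) (by positivity)

end Assembly

end GradTrack

theorem theorem1 {n r : ℕ} (W : Matrix (Fin n) (Fin n) ℝ) (hW : GradTrack.IsCoupling W)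
    (μ L α γ p q : ℝ) (hμ : 0 < μ) (hα : 0 < α) (hγ : 0 < γ) (hp : 0 ≤ p) (hq : 0 ≤ q) :
    ∃ m : ℝ, 0 < m ∧
      ∀ (f : Fin n → GradTrack.Vec r → ℝ), GradTrack.IsObjective f μ L →
      ∀ (xstar : GradTrack.Vec r), GradTrack.IsMinimizer f xstar →
      ∀ (Ω : Type*) [MeasurableSpace Ω] (P : MeasureTheory.Measure Ω)
        [MeasureTheory.IsProbabilityMeasure P]
        (η ξ : ℕ → Fin n → Ω → GradTrack.Vec r) (ση σξ : ℝ), 0 < ση → 0 < σξ →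
        GradTrack.IsNoise P η ξ ση σξ →
      ∀ (s₀ x₀ : Fin n → GradTrack.Vec r),
        -- case 1: constant stepsize
        (p = 0 → 0 < q → GradTrack.StepBound W μ L (α * γ) →
          ∃ C₁ C₂ C₃ : ℝ, ∀ k : ℕ,
            GradTrack.ErrorsLE P W f α (GradTrack.stepSeq γ m p) (GradTrack.noiseSeq m q)
              s₀ x₀ η ξ xstar k
              (C₁ / (m + k) ^ (2 * q))
              (C₂ / (m + k) ^ (2 * q))
              (C₃ / (m + k) ^ (2 * q))) ∧
        -- case 2: slowly decaying stepsize
        (0 < p → p ≤ 1 → p < q → min (2 * q - p) (2 * p) / μ < α * γ →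
          ∃ C₁ C₂ C₃ : ℝ, ∀ k : ℕ,
            GradTrack.ErrorsLE P W f α (GradTrack.stepSeq γ m p) (GradTrack.noiseSeq m q)
              s₀ x₀ η ξ xstar k
              (C₁ / (m + k) ^ min (2 * q - p) (2 * p))
              (C₂ / (m + k) ^ (2 * min q p))
              (C₃ / (m + k) ^ (2 * min q p))) ∧
        -- case 3: fast decaying stepsize
        (1 < p → p / 2 ≤ q →
          ∃ C₀ C₁ C₂ C₃ : ℝ, ∀ k : ℕ,
            GradTrack.ErrorsLE P W f α (GradTrack.stepSeq γ m p) (GradTrack.noiseSeq m q)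
              s₀ x₀ η ξ xstar k
              (C₀ + C₁ / (m + k) ^ p)
              (C₂ / (m + k) ^ (2 * min q p))
              (C₃ / (m + k) ^ (2 * min q p))) := by

  -- The shift `m = 1` only keeps `m + k` positive.
  refine ⟨1, one_pos, fun f hf xstar hx Ω _ P _ η ξ ση σξ _ _ hN s₀ x₀ => ⟨?_, ?_, ?_⟩⟩
  · rintro rfl - hb
    exact GradTrack.exists_rate_constant_step hW hμ hα hγ hq hf hx hN hb
  · intro hp0 hp1 hpq hκ
    obtain ⟨b, c, C₁, C₂, K₁, K₂, u, v, w, hrec, herr⟩ :=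
      GradTrack.exists_decayRecursion (q := q) (s₀ := s₀) (x₀ := x₀) hW hμ hα hγ hp0 hf hx hN
    obtain ⟨C, hC⟩ :=
      GradTrack.exists_rate_decaying_step hrec hp0 (by linarith)
    rw [div_lt_iff₀ hμ] at hκ
    obtain ⟨D, -, hD⟩ := hrec.exists_optimality_rate hp0 hp1 hpq hκ
    refine ⟨D, C, 4 * (C / b), fun k => ?_⟩
    obtain ⟨h1, h2, h3⟩ := hC k
    convert herr k _ _ _ _ (hD k) h1 h2 h3 using 1
    ring
  · intro hp1 hpq
    have hp0 : 0 < p := by linarith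
    obtain ⟨b, c, C₁, C₂, K₁, K₂, u, v, w, hrec, herr⟩ :=
      GradTrack.exists_decayRecursion (q := q) (s₀ := s₀) (x₀ := x₀) hW hμ hα hγ hp0 hf hx hN
    obtain ⟨C, hC⟩ :=
      GradTrack.exists_rate_decaying_step hrec hp0 (by linarith)
    obtain ⟨M, -, hM⟩ := hrec.exists_bound hp0 (by linarith)
    -- Boundedness alone gives the optimality claim: `C₀` is the uniform bound and `C₁ = 0`.
    refine ⟨M, 0, C, 4 * (C / b), fun k => ?_⟩
    obtain ⟨h1, h2, h3⟩ := hC k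
    have hu : u k ≤ M + 0 / (1 + (k : ℝ)) ^ p := by
      rw [zero_div, add_zero]
      linarith [hM k, hrec.v_nonneg k, mul_nonneg hrec.b_pos.le (hrec.w_nonneg k)]
    convert herr k _ _ _ _ hu h1 h2 h3 using 1
    ring
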